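/- Let $d\ge 1$, $1\le p\le\infty$, $1<r<\infty$ and $0\le\kappa<\infty$. On the torus $\mathbb T^d=(\mathbb R/2\pi\mathbb Z)^d$ use the normalized measure $(2\pi)^{-d}dx$ for the norms $\|\cdot\|_p$ of $L^p(\mathbb T^d)$ (complex-valued functions) and for the convolution $(\varphi*g)(x)=(2\pi)^{-d}\int_{\mathbb T^d}\varphi(x-y)g(y)\,dy$. Let $\lambda:\mathbb R\to\mathbb R\setminus\{0\}$ be a mask of type $(r,\kappa)$: $\lambda$ is even and twice continuously differentiable, and there are $F:\mathbb R\to\mathbb R$ and a constant $a_1$ such that $\lambda(t)=|t|^{-r}(\log(|t|+1))^{-\kappa}F(\log|t|)$ for all $t\ge1$, and $|F^{(k)}(t)|\le a_1$ for all $t\ge1$ and $k=0,1,2$. Put $$\varphi_{\lambda,d}(x)=\sum_{j\in\mathbb Z^d}\Big(\prod_{l=1}^d\lambda(j_l)\Big)e^{i(j,x)},\qquad \varphi_\lambda=\varphi_{\lambda,1},$$ $$\mathcal H_{\lambda,p}(\mathbb T^d)=\{\varphi_{\lambda,d}*g:\ g\in L^p(\mathbb T^d)\},\qquad \|\varphi_{\lambda,d}*g\|_{\mathcal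 H_{\lambda,p}(\mathbb T^d)}=\|g\|_p .$$ Let $\vartheta:\mathbb R\to\mathbb R$ be twice continuously differentiable with $\vartheta=1$ on $[-\frac12,\frac12]$ and $\vartheta=0$ outside $(-1,1)$. For $n\in\mathbb N=\{1,2,\dots\}$ let $H_n(x)=\sum_{k\in\mathbb Z}\vartheta(k/n)e^{ikx}$ and, for a univariate function $f=\varphi_\lambda*g$ with $g\in L^1(\mathbb T)$, let $$Q_n(f)=\frac1{2n+1}\sum_{s=0}^{2n}(H_n*g)\Big(\frac{2\pi s}{2n+1}\Big)\,\varphi_\lambda\Big(\cdot-\frac{2\pi s}{2n+1}\Big).$$ Put $q_0=Q_1$ and $q_k=Q_{2^k}-Q_{2^{k-1}}$ for $k\ge1$. For $\boldsymbol k=(k_1,\dots,k_d)$ with integer entries $k_j\ge0$ let $q_{\boldsymbol k}=\prod_{j=1}^d q_{k_j}$, where $q_{k_j}$ is applied in the variable $x_j$ with the other variables held fixed, let $|\boldsymbol k|=k_1+\dots+k_d$, and put $P_m=\sum_{|\boldsymbol k|\le m}q_{\boldsymbol k}$. Then there is a constant $C>0$ such that for every $m\in\mathbb N$ and every $f\in\mathcal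 H_{\lambda,p}(\mathbb T^d)$ one has $P_m(f)\in L^p(\mathbb T^d)$ and $$\|f-P_m(f)\|_p\le C\,2^{-rm}\,m^{d-1-\kappa}\,\|f\|_{\mathcal H_{\lambda,p}(\mathbb T^d)} .$$ -/

import Mathlib

open MeasureTheory
open scoped ENNReal

namespace SparseGrid

noncomputable section

instance factTwoPiPos : Fact ((0 : ℝ) < 2 * Real.pi) := ⟨Real.two_pi_pos⟩

/-- The circle `ℝ / 2πℤ`. -/
abbrev Circ : Type := AddCircle (2 * Real.pi)

/-- The `d`-dimensional torus. -/
abbrev Torus (d : ℕ) : Type := Fin d → Circ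

/-- The normalized measure `dx / (2π)` on the circle. -/
abbrev circMeasure : Measure Circ := AddCircle.haarAddCircle

/-- The normalized measure `dx / (2π)^d` on the torus. -/
abbrev torusMeasure (d : ℕ) : Measure (Torus d) := Measure.pi fun _ => circMeasure

/-- The convolution `(φ * g)(x) = ∫ φ(t) g(x - t) dμ(t)`. For the two normalized measures above its
Fourier coefficients are the products of those of `φ` and `g`. -/
def conv {G : Type*} [AddGroup G] [MeasurableSpace G] (μ : Measure G) (φ g : G → ℂ) : G → ℂ :=
  convolution φ g (ContinuousLinearMap.mul ℂ ℂ) μ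

/-- `lam` is a mask of type `(r, κ)`. (The functional equation determines `F` on `[0, ∞)` and makes
it twice continuously differentiable on `(0, ∞)`, so the derivatives below are genuine.) -/
def IsMask (r κ : ℝ) (lam : ℝ → ℝ) : Prop :=
  (∀ t, lam (-t) = lam t) ∧ ContDiff ℝ 2 lam ∧
    ∃ (F : ℝ → ℝ) (a : ℝ),
      (∀ t : ℝ, 1 ≤ t → lam t = |t| ^ (-r) * Real.log (|t| + 1) ^ (-κ) * F (Real.log |t|)) ∧
      ∀ t : ℝ, 1 ≤ t → ∀ k ∈ Finset.range 3, |iteratedDeriv k F t| ≤ a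

/-- A `C²` cut-off function that is `1` on `[-1/2, 1/2]` and `0` outside `(-1, 1)`. -/
def IsCutoff (ϑ : ℝ → ℝ) : Prop :=
  ContDiff ℝ 2 ϑ ∧ (∀ x ∈ Set.Icc (-(1 / 2) : ℝ) (1 / 2), ϑ x = 1) ∧
    ∀ x, x ∉ Set.Ioo (-1 : ℝ) 1 → ϑ x = 0

/-- `φ_λ(x) = ∑_{j ∈ ℤ} λ(j) e^{ijx}` on the circle. -/
def phi (lam : ℝ → ℝ) (x : Circ) : ℂ := ∑' j : ℤ, (lam j : ℂ) * fourier j x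

/-- `φ_{λ,d}(x) = ∑_{j ∈ ℤ^d} λ(j_1) ⋯ λ(j_d) e^{i(j,x)}` on the torus. -/
def phiTorus (lam : ℝ → ℝ) (d : ℕ) (x : Torus d) : ℂ :=
  ∑' j : Fin d → ℤ, ((∏ l, lam (j l) : ℝ) : ℂ) * ∏ l, fourier (j l) (x l)

/-- `g ∈ L^p(𝕋^d)` is a generator of `f`: `f = φ_{λ,d} * g`, as elements of `L^p`. -/
def IsGenerator (lam : ℝ → ℝ) (p : ℝ≥0∞) {d : ℕ} (f g : Torus d → ℂ) : Prop :=
  MemLp g p (torusMeasure d) ∧ f =ᵐ[torusMeasure d] conv (torusMeasure d) (phiTorus lam d) g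

/-- The space `H_{λ,p}(𝕋^d)`. -/
def hSpace (lam : ℝ → ℝ) (p : ℝ≥0∞) (d : ℕ) : Set (Torus d → ℂ) :=
  {f | ∃ g, IsGenerator lam p f g}

/-- The norm `‖f‖_{H_{λ,p}(𝕋^d)} = ‖g‖_p` for `f = φ_{λ,d} * g`. When `λ` has no zeros, `g` is
unique almost everywhere, so that the infimum is over a single value; it is `∞` if `f` is not in
the space. -/
def hNorm (lam : ℝ → ℝ) (p : ℝ≥0∞) {d : ℕ} (f : Torus d → ℂ) : ℝ≥0∞ :=
  ⨅ (g : Torus d → ℂ) (_ : IsGenerator lam p f g), eLpNorm g p (torusMeasure d)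

/-- `H_m(x) = ∑_{k ∈ ℤ} ϑ(k/m) (λ(k)/β(k)) e^{ikx}`. -/
def Hker (ϑ lam bet : ℝ → ℝ) (m : ℕ) (x : Circ) : ℂ :=
  ∑' k : ℤ, ((ϑ (k / m) * (lam k / bet k) : ℝ) : ℂ) * fourier k x

open Classical in
/-- The univariate operator
`Q_{m,β}(f) = (2m+1)⁻¹ ∑_{k=0}^{2m} (H_m * g)(2πk/(2m+1)) φ_β(· - 2πk/(2m+1))`
for `f = φ_λ * g` with integrable `g`. When `λ` has no zeros, `g` is unique almost everywhere, so
the value does not depend on the choice of `g`, nor on that of an exponent `p`. It is `0` for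
functions that are not of this form. -/
def Qop (ϑ lam bet : ℝ → ℝ) (m : ℕ) (f : Circ → ℂ) (x : Circ) : ℂ :=
  if h : ∃ g : Circ → ℂ, Integrable g circMeasure ∧
      f =ᵐ[circMeasure] conv circMeasure (phi lam) g then
    (2 * (m : ℂ) + 1)⁻¹ * ∑ k ∈ Finset.range (2 * m + 1),
      conv circMeasure (Hker ϑ lam bet m) h.choose
          ((2 * Real.pi * k / (2 * m + 1) : ℝ) : Circ) *
        phi bet (x - ((2 * Real.pi * k / (2 * m + 1) : ℝ) : Circ))
  else 0

/-- `q_0 = Q_{1,λ}` and `q_k = Q_{2^k,λ} - Q_{2^(k-1),λ}` for `k > 0`. -/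
def qop (ϑ lam : ℝ → ℝ) : ℕ → (Circ → ℂ) → Circ → ℂ
  | 0, f => Qop ϑ lam lam 1 f
  | k + 1, f => Qop ϑ lam lam (2 ^ (k + 1)) f - Qop ϑ lam lam (2 ^ k) f

/-- A univariate operator `A`, applied to `f` as a function of the variable `x_j` with the other
variables held fixed. -/
def coordOp {d : ℕ} (j : Fin d) (A : (Circ → ℂ) → Circ → ℂ) (f : Torus d → ℂ) : Torus d → ℂ :=
  fun x => A (fun t => f (Function.update x j t)) (x j)

/-- `q_k = q_{k_1} ⋯ q_{k_d}`, where `q_{k_j}` acts in the variable `x_j`. -/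
def qopTorus (ϑ lam : ℝ → ℝ) {d : ℕ} (k : Fin d → ℕ) (f : Torus d → ℂ) : Torus d → ℂ :=
  (List.finRange d).foldr (fun j F => coordOp j (qop ϑ lam (k j)) F) f

/-- The sparse-grid operator `P_m = ∑_{|k| ≤ m} q_k`, over `k ∈ ℤ^d` with nonnegative entries. -/
def Pop (ϑ lam : ℝ → ℝ) {d : ℕ} (m : ℕ) (f : Torus d → ℂ) : Torus d → ℂ :=
  ∑ k ∈ (Fintype.piFinset fun _ : Fin d => Finset.range (m + 1)) with ∑ j, k j ≤ m,
    qopTorus ϑ lam k f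

end

end SparseGrid

namespace SparseGrid

noncomputable section

/-! Every operator involved becomes an integral operator applied to the generator `g`, so the
theorem reduces to bounding the row and column `L^1` norms of one kernel. Schur's test
(`SchurBound.eLpNorm_intOp_le`) then gives the estimate for all `p` at once.

In one variable `Q_n` has the kernel `sampleKer`. A product of two trigonometric polynomials of
degree at most `n` is averaged exactly by the grid of `2n+1` points, so `φ_λ(x-y)` minus this kernel
contains only multipliers vanishing for `|k| ≤ n/2` (`phi_sub_sampleKer`). The mask and two
derivatives decay like `t^{-r} (log t)^{-κ}`, with a further factor `1/t` per derivative; a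
second-difference argument bounds the remaining kernels by `rate r κ n` times the localized function
`bump n`, whose integral and grid means are at most 3. Hence `φ_λ - Q_{2^k}` and `q_k` both have
Schur norm `O(2^{-rk} (k+1)^{-κ})` (`exists_schurBound_dyadic`).

In several variables, with `Φ_d` the convolution with `φ_{λ,d}`, the sum of `q_k` telescopes to
`Q_{2^m}`, and `Φ_{d+1} - P_m = (φ_λ - Q_{2^m}) ⊗ Φ_d + ∑_{k ≤ m} q_k ⊗ (Φ_d - P_{m-k})`. The rates
are submultiplicative, since `(k+1)(j+1) ≥ k+j+1`. Each of the `m+1` summands is therefore no larger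
than the rate at level `m`, and every variable after the first costs one factor `m+1`. This is the
source of the power `m^{d-1}`.

It remains to identify `P_m f` with the operator of kernel `sparseKer` almost everywhere, although
`Qop` selects a generator by choice and acts on one-dimensional sections (`Qop_eq_intOp`,
`coordOp_qop_ae_eq`). -/

/-! ### Roots of unity and the localized majorant. -/

/-- The `s`-th point of the equidistant grid with `2n+1` points. -/
def gridPt (n s : ℕ) : Circ := ((2 * Real.pi * s / (2 * n + 1) : ℝ) : Circ)

/-- The primitive root of unity `e^{2πi/(2n+1)}`. -/
def gridRoot (n : ℕ) : ℂ := Complex.exp (2 * Real.pi * Complex.I / (2 * n + 1 : ℕ))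

lemma isPrimitiveRoot_gridRoot (n : ℕ) : IsPrimitiveRoot (gridRoot n) (2 * n + 1) :=
  Complex.isPrimitiveRoot_exp _ (by omega)

lemma fourier_gridPt (n s : ℕ) (k : ℤ) : fourier k (gridPt n s) = (gridRoot n ^ k) ^ s := by
  rw [gridPt, fourier_coe_apply, gridRoot, ← Complex.exp_int_mul, ← Complex.exp_nat_mul]
  congr 1
  have h1 : (Real.pi : ℂ) ≠ 0 := by exact_mod_cast Real.pi_ne_zero
  have h2 : (2 * n + 1 : ℂ) ≠ 0 := by exact_mod_cast (by omega : 2 * n + 1 ≠ 0)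
  push_cast
  field_simp

lemma norm_fourier (k : ℤ) (x : Circ) : ‖fourier k x‖ = 1 := by
  rw [fourier_apply]; exact Circle.norm_coe _

lemma fourier_sub_apply (k : ℤ) (x y : Circ) :
    fourier k (x - y) = fourier k x * fourier (-k) y := by
  simp only [fourier_apply, sub_eq_add_neg, smul_add, smul_neg, AddCircle.toCircle_add, neg_smul,
    Circle.coe_mul]

lemma fourier_neg_apply (k : ℤ) (x : Circ) : fourier k (-x) = fourier (-k) x := by
  simp only [fourier_apply, smul_neg, neg_smul]

lemma fourier_mul_fourier_neg (k : ℤ) (x : Circ) : fourier k x * fourier (-k) x = 1 := by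
  rw [← fourier_add]; simp

lemma sum_gridRoot_pow (n : ℕ) (k : ℤ) (hk : ¬ ((2 * n + 1 : ℕ) : ℤ) ∣ k) :
    ∑ s ∈ Finset.range (2 * n + 1), (gridRoot n ^ k) ^ s = 0 := by
  have h := isPrimitiveRoot_gridRoot n
  have h1 : gridRoot n ^ k ≠ 1 := fun h' => hk ((h.zpow_eq_one_iff_dvd k).1 h')
  have h2 : (gridRoot n ^ k) ^ (2 * n + 1) = 1 := by
    rw [← zpow_natCast, ← zpow_mul, mul_comm, zpow_mul, zpow_natCast, h.pow_eq_one, one_zpow]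
  have := geom_sum_eq h1 (2 * n + 1)
  rw [this, h2, sub_self, zero_div]

/-- The localized majorant `n / (1 + n² |1 - e^{ix}|²)`. -/
def bump (n : ℕ) (x : Circ) : ℝ := n / (1 + n ^ 2 * ‖1 - fourier 1 x‖ ^ 2)

lemma bump_nonneg (n : ℕ) (x : Circ) : 0 ≤ bump n x := by unfold bump; positivity

lemma continuous_bump (n : ℕ) : Continuous (bump n) := by
  unfold bump
  refine Continuous.div (by fun_prop) (by fun_prop) fun x => by positivity

lemma bump_neg (n : ℕ) (x : Circ) : bump n (-x) = bump n x := by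
  have : ‖1 - fourier 1 (-x)‖ = ‖1 - fourier 1 x‖ := by
    rw [fourier_neg_apply, fourier_neg, ← RCLike.norm_conj (1 - fourier 1 x)]
    simp
  rw [bump, bump, this]

lemma bump_sub_comm (n : ℕ) (x y : Circ) : bump n (x - y) = bump n (y - x) := by
  rw [← bump_neg, neg_sub]

/-- Each summand is a geometric sum `∑_{j<2n+1} (z ω^s)^j` divided by `1 - z^{2n+1}`; summation over
`s` kills every power except `j = 0`. -/
lemma sum_inv_one_sub_mul_gridRoot_pow (n : ℕ) (z : ℂ) (hz : ‖z‖ < 1) :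
    ∑ s ∈ Finset.range (2 * n + 1), (1 - z * gridRoot n ^ s)⁻¹ =
      (2 * n + 1) * (1 - z ^ (2 * n + 1))⁻¹ := by
  have h := isPrimitiveRoot_gridRoot n
  have hne : ∀ w : ℂ, ‖w‖ < 1 → (1 - w) ≠ 0 := fun w hw h0 => by
    rw [← sub_eq_zero.1 h0] at hw; simp at hw
  have hzN : 1 - z ^ (2 * n + 1) ≠ 0 := hne _ (by
    rw [norm_pow]; exact pow_lt_one₀ (norm_nonneg _) hz (by omega))
  have hnorm : ‖gridRoot n‖ = 1 := h.norm'_eq_one (by omega)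
  have h1 : ∀ s, (1 - z * gridRoot n ^ s)⁻¹ =
      (∑ j ∈ Finset.range (2 * n + 1), z ^ j * (gridRoot n ^ (j : ℤ)) ^ s) *
        (1 - z ^ (2 * n + 1))⁻¹ := fun s => by
    have h0 : 1 - z * gridRoot n ^ s ≠ 0 := hne _ (by simpa [hnorm] using hz)
    have h2 := mul_neg_geom_sum (z * gridRoot n ^ s) (2 * n + 1)
    rw [mul_pow, ← pow_mul, mul_comm s, pow_mul, h.pow_eq_one, one_pow, mul_one] at h2
    rw [eq_mul_inv_iff_mul_eq₀ hzN, ← h2, inv_mul_cancel_left₀ h0]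
    refine Finset.sum_congr rfl fun j _ => ?_
    rw [mul_pow, zpow_natCast, ← pow_mul, ← pow_mul, mul_comm s]
  simp_rw [h1]
  rw [← Finset.sum_mul, Finset.sum_comm]
  congr 1
  simp_rw [← Finset.mul_sum]
  rw [Finset.sum_eq_single 0]
  · simp
  · intro j hj hj0
    rw [sum_gridRoot_pow, mul_zero]
    intro hd
    have := Int.natCast_dvd_natCast.1 hd
    exact absurd (Nat.le_of_dvd (by omega) this) (by simpa using hj)
  · simp

lemma norm_one_sub_mul_sq (ρ : ℝ) (e : ℂ) (he : ‖e‖ = 1) :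
    ‖1 - ρ * e‖ ^ 2 = (1 - ρ) ^ 2 + ρ * ‖1 - e‖ ^ 2 := by
  have h : e.re ^ 2 + e.im ^ 2 = 1 := by
    have := Complex.sq_norm e
    rw [he, Complex.normSq_apply] at this; nlinarith
  rw [Complex.sq_norm, Complex.sq_norm, Complex.normSq_apply, Complex.normSq_apply]
  simp
  linear_combination (ρ ^ 2 - ρ) * h

/-- The right-hand side is the Poisson kernel `(1-ρ²)/|1-ρe^{ix}|²` of radius `ρ = 1 - 1/n`. It
dominates `bump n` and, unlike `bump n`, can be averaged over the grid in closed form. -/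
lemma bump_le_re (n : ℕ) (hn : 1 ≤ n) (x : Circ) :
    bump n x ≤ 2 * ((1 - ((1 - 1 / n : ℝ) : ℂ) * fourier 1 x)⁻¹).re - 1 := by
  have hn' : (1 : ℝ) ≤ n := by exact_mod_cast hn
  set ρ : ℝ := 1 - 1 / n with hρ
  have h1n : (1 : ℝ) / n ≤ 1 := by rw [div_le_one (by positivity)]; exact hn'
  have h1n' : (0 : ℝ) < 1 / n := by positivity
  set e := fourier 1 x with he
  have hen : ‖e‖ = 1 := norm_fourier _ _
  have hre : e.re ^ 2 + e.im ^ 2 = 1 := by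
    have := Complex.sq_norm e
    rw [hen, Complex.normSq_apply] at this; nlinarith
  have hN := norm_one_sub_mul_sq ρ e hen
  have hpos : 0 < ‖1 - ρ * e‖ ^ 2 := by
    rw [hN]
    have : 0 ≤ ρ := by rw [hρ]; linarith
    have : 0 < 1 - ρ := by rw [hρ]; linarith
    positivity
  have hρ0 : 0 ≤ ρ := by rw [hρ]; linarith
  have key : 2 * ((1 - (ρ : ℂ) * e)⁻¹).re - 1 = (1 - ρ ^ 2) / ‖1 - ρ * e‖ ^ 2 := by
    rw [Complex.inv_re, Complex.normSq_eq_norm_sq, eq_div_iff hpos.ne', sub_mul, ← mul_div_assoc,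
      div_mul_cancel₀ _ hpos.ne', Complex.sq_norm, Complex.normSq_apply]
    simp
    linear_combination -ρ ^ 2 * hre
  rw [key, hN, bump]
  have hnρ : (n : ℝ) * (1 - ρ) = 1 := by rw [hρ]; field_simp; ring
  rw [div_le_div_iff₀ (by positivity) (by rw [← hN]; exact hpos)]
  set q := ‖1 - e‖ ^ 2 with hq
  have hq0 : 0 ≤ q := by positivity
  have hρ1 : ρ ≤ 1 := by rw [hρ]; linarith
  have e1 : (1 - ρ ^ 2) * (1 + n ^ 2 * q) = (1 + ρ) * ((1 - ρ) + n * q * (n * (1 - ρ))) := by ring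
  rw [e1, hnρ]
  have e2 : (n : ℝ) * ((1 - ρ) ^ 2 + ρ * q) = (n * (1 - ρ)) * (1 - ρ) + n * q * ρ := by ring
  rw [e2, hnρ]
  nlinarith [mul_nonneg hρ0 (sub_nonneg.2 hρ1), mul_nonneg (by positivity : (0:ℝ) ≤ n) hq0]

lemma one_sub_inv_pow_le (n : ℕ) (hn : 1 ≤ n) : (1 - 1 / n : ℝ) ^ (2 * n + 1) ≤ 1 / 2 := by
  have hn' : (1 : ℝ) ≤ n := by exact_mod_cast hn
  have h1n : (1 : ℝ) / n ≤ 1 := by rw [div_le_one (by positivity)]; exact hn'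
  have h1 : (1 - 1 / n : ℝ) ^ n ≤ Real.exp (-1) := by
    calc (1 - 1 / n : ℝ) ^ n ≤ (Real.exp (-(1 / n))) ^ n :=
          pow_le_pow_left₀ (by linarith) (Real.one_sub_le_exp_neg _) _
      _ = Real.exp (-1) := by rw [← Real.exp_nat_mul]; congr 1; field_simp
  have h2 : Real.exp (-1) ≤ 1 / 2 := by
    rw [Real.exp_neg, one_div]
    exact inv_anti₀ (by norm_num) (by linarith [Real.add_one_le_exp (1 : ℝ)])
  have h0 : 0 ≤ (1 - 1 / n : ℝ) := by linarith
  calc (1 - 1 / n : ℝ) ^ (2 * n + 1) ≤ (1 - 1 / n : ℝ) ^ n :=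
        pow_le_pow_of_le_one h0 (by have : (0:ℝ) < 1 / n := by positivity
                                    linarith) (by omega)
    _ ≤ _ := h1.trans h2

/-- The grid mean of the Poisson kernel is again `2 Re (1-w)⁻¹ - 1`, now with `w = z^{2n+1}`. As
`|w| ≤ 1/2`, this is at most `2 · 2 - 1 = 3`. -/
lemma mean_bump_le (n : ℕ) (hn : 1 ≤ n) (x : Circ) :
    (2 * n + 1 : ℝ)⁻¹ * ∑ s ∈ Finset.range (2 * n + 1), bump n (gridPt n s - x) ≤ 3 := by
  have hn' : (1 : ℝ) ≤ n := by exact_mod_cast hn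
  have h1n : (1 : ℝ) / n ≤ 1 := by rw [div_le_one (by positivity)]; exact hn'
  have h1n' : (0 : ℝ) < 1 / n := by positivity
  set z : ℂ := ((1 - 1 / n : ℝ) : ℂ) * fourier (-1) x with hz
  have hznorm : ‖z‖ = 1 - 1 / n := by
    rw [hz, norm_mul, norm_fourier, mul_one, Complex.norm_real, Real.norm_of_nonneg (by linarith)]
  have hw : ‖z ^ (2 * n + 1)‖ ≤ 1 / 2 := by
    rw [norm_pow, hznorm]; exact one_sub_inv_pow_le n hn
  set w := z ^ (2 * n + 1) with hwdef
  have hsum : ∑ s ∈ Finset.range (2 * n + 1), bump n (gridPt n s - x) ≤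
      (2 * n + 1) * (2 * ((1 - w)⁻¹).re - 1) := by
    calc ∑ s ∈ Finset.range (2 * n + 1), bump n (gridPt n s - x)
        ≤ ∑ s ∈ Finset.range (2 * n + 1), (2 * ((1 - z * gridRoot n ^ s)⁻¹).re - 1) := by
          refine Finset.sum_le_sum fun s _ => ?_
          refine (bump_le_re n hn _).trans (le_of_eq ?_)
          rw [fourier_sub_apply, fourier_gridPt, hz, zpow_one]
          congr 5
          ring
      _ = _ := by
          rw [Finset.sum_sub_distrib, ← Finset.mul_sum, ← Complex.re_sum,
            sum_inv_one_sub_mul_gridRoot_pow n z (by rw [hznorm]; linarith)]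
          have : ((2 * (n : ℂ) + 1) * (1 - w)⁻¹).re = (2 * n + 1) * ((1 - w)⁻¹).re := by
            rw [← Complex.re_ofReal_mul]; push_cast; rfl
          rw [this]; simp; ring
  have hre : ((1 - w)⁻¹).re ≤ 2 := by
    refine (Complex.re_le_norm _).trans ?_
    rw [norm_inv]
    have : 1 / 2 ≤ ‖1 - w‖ := by
      have := norm_sub_norm_le (1 : ℂ) w
      rw [norm_one] at this; linarith
    calc ‖1 - w‖⁻¹ ≤ (1 / 2)⁻¹ := inv_anti₀ (by norm_num) this
      _ = 2 := by norm_num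
  rw [inv_mul_le_iff₀ (by positivity)]
  refine hsum.trans ?_
  rw [mul_comm (2 * (n:ℝ) + 1) 3, mul_comm]
  gcongr
  linarith

/-- By translation invariance, integrating the grid mean over its shift returns the integral of
`bump n`. -/
lemma integral_bump_le (n : ℕ) (hn : 1 ≤ n) : ∫ x, bump n x ∂circMeasure ≤ 3 := by
  have hint : ∀ y, Integrable (fun x => bump n (y - x)) circMeasure := fun y =>
    ((continuous_bump n).comp (by fun_prop)).integrable_of_hasCompactSupport
      (HasCompactSupport.of_compactSpace _)
  have h : ∫ x, (2 * n + 1 : ℝ)⁻¹ * ∑ s ∈ Finset.range (2 * n + 1), bump n (gridPt n s - x)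
      ∂circMeasure = ∫ x, bump n x ∂circMeasure := by
    rw [integral_const_mul, integral_finsetSum _ fun s _ => hint _]
    simp_rw [integral_sub_left_eq_self (bump n) circMeasure]
    simp
    field_simp
  rw [← h]
  calc _ ≤ ∫ _, (3 : ℝ) ∂circMeasure := by
        refine integral_mono ?_ (integrable_const _) fun x => mean_bump_le n hn x
        exact (integrable_finsetSum _ fun s _ => hint _).const_mul _
    _ = 3 := by simp

/-! ### Trigonometric series and second differences of their coefficients. -/

/-- The trigonometric series `∑ a_k e^{ikx}`. -/
def trig (a : ℤ → ℝ) (x : Circ) : ℂ := ∑' k, (a k : ℂ) * fourier k x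

lemma norm_coeff_mul_fourier (a : ℤ → ℝ) (k : ℤ) (x : Circ) : ‖(a k : ℂ) * fourier k x‖ = |a k| := by
  rw [norm_mul, norm_fourier, mul_one, Complex.norm_real, Real.norm_eq_abs]

lemma summable_trig {a : ℤ → ℝ} (ha : Summable fun k => |a k|) (x : Circ) :
    Summable fun k => (a k : ℂ) * fourier k x :=
  Summable.of_norm (by simpa only [norm_coeff_mul_fourier] using ha)

lemma continuous_trig {a : ℤ → ℝ} (ha : Summable fun k => |a k|) : Continuous (trig a) :=
  continuous_tsum (fun k => by fun_prop) ha fun k x => (norm_coeff_mul_fourier a k x).le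

lemma norm_trig_le {a : ℤ → ℝ} (ha : Summable fun k => |a k|) (x : Circ) :
    ‖trig a x‖ ≤ ∑' k, |a k| := by
  refine (norm_tsum_le_tsum_norm ?_).trans (le_of_eq ?_) <;> simp only [norm_coeff_mul_fourier]
  exact ha

lemma trig_sub {a b : ℤ → ℝ} (ha : Summable fun k => |a k|) (hb : Summable fun k => |b k|)
    (x : Circ) : trig (fun k => a k - b k) x = trig a x - trig b x := by
  unfold trig
  rw [← (summable_trig ha x).tsum_sub (summable_trig hb x)]
  refine tsum_congr fun k => ?_
  push_cast; ring

lemma fourier_mul_trig (a : ℤ → ℝ) (m : ℤ) (x : Circ) :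
    fourier m x * trig a x = trig (fun k => a (k - m)) x := by
  unfold trig
  rw [← tsum_mul_left,
    ← (Equiv.addRight m).tsum_eq fun k => ((a (k - m) : ℝ) : ℂ) * fourier k x]
  refine tsum_congr fun k => ?_
  simp only [Equiv.coe_addRight, add_sub_cancel_right, fourier_add]
  ring

lemma summable_shift {a : ℤ → ℝ} (ha : Summable fun k => |a k|) (m : ℤ) :
    Summable fun k => |a (k - m)| :=
  (Equiv.subRight m).summable_iff.2 ha

lemma norm_sq_one_sub_fourier (x : Circ) :
    ((‖1 - fourier 1 x‖ ^ 2 : ℝ) : ℂ) = 2 - fourier 1 x - fourier (-1) x := by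
  rw [Complex.sq_norm, ← Complex.mul_conj]
  have h := fourier_mul_fourier_neg 1 x
  rw [fourier_neg] at h ⊢
  rw [map_sub, map_one]
  linear_combination h

/-- Multiplication by `|1-e^{ix}|² = 2 - e^{ix} - e^{-ix}` turns the coefficients into their negated
second difference. Adding this bound, weighted by `n²`, to the trivial one produces the denominator
of `bump n`. -/
lemma norm_trig_le_bump {a : ℤ → ℝ} (ha : Summable fun k => |a k|) {n : ℕ} (hn : 1 ≤ n) {M : ℝ}
    (hM : ∑' k, |a k| + n ^ 2 * ∑' k, |a (k + 1) - 2 * a k + a (k - 1)| ≤ M) (x : Circ) :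
    ‖trig a x‖ ≤ M / n * bump n x := by
  have hn0 : (0 : ℝ) < n := by exact_mod_cast hn
  have s1 := summable_shift ha 1
  have s2 := summable_shift ha (-1)
  simp only [sub_neg_eq_add] at s2
  have hs : Summable fun k => |a (k + 1) - 2 * a k + a (k - 1)| := by
    refine Summable.of_nonneg_of_le (fun _ => abs_nonneg _) (fun k => ?_)
      ((s2.add (ha.mul_left 2)).add s1)
    calc _ ≤ |a (k + 1) - 2 * a k| + |a (k - 1)| := abs_add_le _ _
      _ ≤ |a (k + 1)| + |2 * a k| + |a (k - 1)| := by gcongr; exact abs_sub _ _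
      _ = _ := by rw [abs_mul, abs_two]
  have h2 : ‖1 - fourier 1 x‖ ^ 2 * ‖trig a x‖ ≤ ∑' k, |a (k + 1) - 2 * a k + a (k - 1)| := by
    have e : ((‖1 - fourier 1 x‖ ^ 2 : ℝ) : ℂ) * trig a x =
        - trig (fun k => a (k + 1) - 2 * a k + a (k - 1)) x := by
      rw [norm_sq_one_sub_fourier, sub_mul, sub_mul, fourier_mul_trig, fourier_mul_trig]
      simp only [sub_neg_eq_add]
      unfold trig
      rw [← tsum_mul_left, ← ((summable_trig ha x).mul_left 2).tsum_sub (summable_trig s1 x),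
        ← (((summable_trig ha x).mul_left 2).sub (summable_trig s1 x)).tsum_sub
          (summable_trig s2 x), ← tsum_neg]
      refine tsum_congr fun k => ?_
      push_cast; ring
    calc _ = ‖((‖1 - fourier 1 x‖ ^ 2 : ℝ) : ℂ) * trig a x‖ := by
          rw [norm_mul, Complex.norm_real, Real.norm_of_nonneg (by positivity)]
      _ ≤ _ := by rw [e, norm_neg]; exact norm_trig_le hs x
  have h3 : ‖trig a x‖ * (1 + n ^ 2 * ‖1 - fourier 1 x‖ ^ 2) ≤ M := by
    refine le_trans ?_ hM
    have := norm_trig_le ha x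
    nlinarith [mul_le_mul_of_nonneg_left h2 (by positivity : (0:ℝ) ≤ (n:ℝ) ^ 2)]
  rw [bump]
  rw [div_mul_div_comm, mul_comm M, mul_div_mul_left _ _ hn0.ne', le_div_iff₀ (by positivity)]
  exact h3

lemma exists_second_difference_eq {u u' u'' : ℝ → ℝ} (h1 : ∀ t, HasDerivAt u (u' t) t)
    (h2 : ∀ t, HasDerivAt u' (u'' t) t) (x : ℝ) :
    ∃ y, |y - x| ≤ 1 ∧ u (x + 1) - 2 * u x + u (x - 1) = u'' y := by
  have hv : ∀ t, HasDerivAt (fun t => u (t + 1) - u t) (u' (t + 1) - u' t) t := fun t =>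
    ((h1 (t + 1)).comp_add_const t 1).sub (h1 t)
  obtain ⟨c, hc, hc'⟩ := exists_hasDerivAt_eq_slope (fun t => u (t + 1) - u t)
    (fun t => u' (t + 1) - u' t) (by linarith : x - 1 < x)
    (fun t _ => (hv t).continuousAt.continuousWithinAt) (fun t _ => hv t)
  obtain ⟨y, hy, hy'⟩ := exists_hasDerivAt_eq_slope u' u'' (by linarith : c < c + 1)
    (fun t _ => (h2 t).continuousAt.continuousWithinAt) (fun t _ => h2 t)
  refine ⟨y, ?_, ?_⟩
  · rw [abs_le]; constructor <;> linarith [hc.1, hc.2, hy.1, hy.2]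
  · rw [hy', add_sub_cancel_left, div_one, hc']
    simp
    ring

/-- The mean value theorem gives a difference `(r-1) c^{-r}` with `c < x+1 ≤ 2x`. The right-hand
side telescopes in sums. -/
lemma rpow_neg_le_sub {r x : ℝ} (hr : 1 < r) (hx : 1 ≤ x) :
    x ^ (-r) ≤ 2 ^ r / (r - 1) * (x ^ (1 - r) - (x + 1) ^ (1 - r)) := by
  have hx0 : 0 < x := by linarith
  have hd : ∀ t, 0 < t → HasDerivAt (fun t : ℝ => t ^ (1 - r)) ((1 - r) * t ^ (-r)) t := fun t ht => by
    have := Real.hasDerivAt_rpow_const (x := t) (p := 1 - r) (Or.inl ht.ne')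
    convert this using 2
    ring_nf
  obtain ⟨c, hc, hc'⟩ := exists_hasDerivAt_eq_slope (fun t : ℝ => t ^ (1 - r)) _
    (by linarith : x < x + 1)
    (fun t ht => (hd t (by linarith [ht.1])).continuousAt.continuousWithinAt)
    (fun t ht => hd t (by linarith [ht.1]))
  rw [add_sub_cancel_left, div_one] at hc'
  have h1 : x ^ (1 - r) - (x + 1) ^ (1 - r) = (r - 1) * c ^ (-r) := by linarith
  have h2 : (2 * x) ^ (-r) ≤ c ^ (-r) :=
    Real.rpow_le_rpow_of_nonpos (by linarith [hc.1]) (by linarith [hc.2]) (by linarith)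
  rw [Real.mul_rpow (by norm_num) hx0.le, Real.rpow_neg (by norm_num : (0:ℝ) ≤ 2)] at h2
  have h3 : (0 : ℝ) < 2 ^ r := by positivity
  rw [h1, ← mul_assoc, div_mul_cancel₀ _ (by linarith : r - 1 ≠ 0)]
  rwa [inv_mul_le_iff₀ h3] at h2

lemma sum_add_rpow_neg_le {r : ℝ} (hr : 1 < r) {n : ℕ} (hn : 1 ≤ n) (N : ℕ) :
    ∑ k ∈ Finset.range N, ((n : ℝ) + k) ^ (-r) ≤ 2 ^ r / (r - 1) * (n : ℝ) ^ (1 - r) := by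
  have hn' : (1 : ℝ) ≤ n := by exact_mod_cast hn
  have hB : 0 ≤ 2 ^ r / (r - 1) := div_nonneg (by positivity) (by linarith)
  calc _ ≤ ∑ k ∈ Finset.range N, 2 ^ r / (r - 1) *
        (((n : ℝ) + k) ^ (1 - r) - ((n : ℝ) + (k + 1 : ℕ)) ^ (1 - r)) := by
        refine Finset.sum_le_sum fun k _ => ?_
        have := rpow_neg_le_sub hr (by linarith [(Nat.cast_nonneg k : (0:ℝ) ≤ k)] : (1:ℝ) ≤ n + k)
        push_cast
        rwa [← add_assoc]
    _ = 2 ^ r / (r - 1) * ((n : ℝ) ^ (1 - r) - ((n : ℝ) + N) ^ (1 - r)) := by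
        rw [← Finset.mul_sum, Finset.sum_range_sub' (fun k : ℕ => ((n : ℝ) + k) ^ (1 - r))]
        simp
    _ ≤ _ := by
        refine mul_le_mul_of_nonneg_left ?_ hB
        have : (0 : ℝ) ≤ ((n : ℝ) + N) ^ (1 - r) := by positivity
        linarith

lemma summable_int_rpow_neg {r : ℝ} (hr : 1 < r) {n : ℕ} (hn : 1 ≤ n) :
    Summable (fun k : ℤ => ((n : ℝ) + |(k : ℝ)|) ^ (-r)) ∧
      ∑' k : ℤ, ((n : ℝ) + |(k : ℝ)|) ^ (-r) ≤ 2 * (2 ^ r / (r - 1)) * (n : ℝ) ^ (1 - r) := by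
  have hs : Summable fun k : ℕ => ((n : ℝ) + k) ^ (-r) :=
    summable_of_sum_range_le (fun _ => by positivity) (sum_add_rpow_neg_le hr hn)
  have ht := Real.tsum_le_of_sum_range_le (fun k : ℕ => (by positivity : 0 ≤ ((n : ℝ) + k) ^ (-r)))
    (sum_add_rpow_neg_le hr hn)
  have hS := HasSum.of_nat_of_neg (f := fun k : ℤ => ((n : ℝ) + |(k : ℝ)|) ^ (-r))
    (by simpa using hs.hasSum) (by simpa using hs.hasSum)
  refine ⟨hS.summable, ?_⟩
  rw [hS.tsum_eq]
  -- The two half-line sums both contain `k = 0`; the subtracted duplicate may be dropped.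
  refine (sub_le_self _ (by positivity)).trans ?_
  rw [mul_assoc, two_mul]
  exact add_le_add ht ht

/-- A constant for `norm_trig_le_of_decay`, depending on the decay exponent only. -/
def decayConst (r : ℝ) : ℝ := 2 * (2 ^ r / (r - 1)) * (1 + 2 ^ r)

lemma decayConst_nonneg {r : ℝ} (hr : 1 < r) : 0 ≤ decayConst r := by
  have : 0 < r - 1 := by linarith
  unfold decayConst; positivity

lemma summable_of_decay {r : ℝ} (hr : 1 < r) {n : ℕ} (hn : 1 ≤ n) {A : ℝ} {u : ℝ → ℝ}
    (hu : ∀ t, |u t| ≤ A * (n + |t|) ^ (-r)) : Summable fun k : ℤ => |u k| :=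
  Summable.of_nonneg_of_le (fun _ => abs_nonneg _) (fun k => hu k)
    ((summable_int_rpow_neg hr hn).1.mul_left A)

/-- Decay of `u` and of `n² u''` at the same rate makes both sums in `norm_trig_le_bump` of order
`n^{1-r}`, because a second difference is a value of `u''` at a point within distance 1. -/
lemma norm_trig_le_of_decay {r : ℝ} (hr : 1 < r) {n : ℕ} (hn : 1 ≤ n) {A : ℝ}
    {u u' u'' : ℝ → ℝ} (h1 : ∀ t, HasDerivAt u (u' t) t) (h2 : ∀ t, HasDerivAt u' (u'' t) t)
    (hu : ∀ t, |u t| ≤ A * (n + |t|) ^ (-r)) (hu'' : ∀ t, n ^ 2 * |u'' t| ≤ A * (n + |t|) ^ (-r))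
    (x : Circ) :
    ‖trig (fun k => u k) x‖ ≤ decayConst r * A * (n : ℝ) ^ (-r) * bump n x := by
  have hn0 : (0 : ℝ) < n := by exact_mod_cast hn
  have hn1 : (1 : ℝ) ≤ n := by exact_mod_cast hn
  obtain ⟨hs, ht⟩ := summable_int_rpow_neg hr hn
  have hsu := summable_of_decay hr hn hu
  have hA : 0 ≤ A := by
    have := (abs_nonneg _).trans (hu 0)
    exact nonneg_of_mul_nonneg_left this (by positivity)
  have hd : ∀ k : ℤ, n ^ 2 * |u ((k + 1 : ℤ)) - 2 * u k + u ((k - 1 : ℤ))| ≤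
      A * 2 ^ r * ((n : ℝ) + |(k : ℝ)|) ^ (-r) := fun k => by
    obtain ⟨y, hy, hy'⟩ := exists_second_difference_eq h1 h2 (k : ℝ)
    push_cast
    rw [hy', mul_assoc]
    refine (hu'' y).trans (mul_le_mul_of_nonneg_left ?_ hA)
    have hk : |(k : ℝ)| ≤ |y| + 1 := by
      have := abs_sub_abs_le_abs_sub (k : ℝ) y
      rw [abs_sub_comm] at this; linarith
    have h3 : ((n : ℝ) + |(k : ℝ)|) / 2 ≤ n + |y| := by linarith [abs_nonneg y]
    calc (n + |y|) ^ (-r) ≤ (((n : ℝ) + |(k : ℝ)|) / 2) ^ (-r) :=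
          Real.rpow_le_rpow_of_nonpos (by positivity) h3 (by linarith)
      _ = 2 ^ r * ((n : ℝ) + |(k : ℝ)|) ^ (-r) := by
          rw [Real.div_rpow (by positivity) (by norm_num), Real.rpow_neg (by norm_num : (0:ℝ) ≤ 2),
            div_inv_eq_mul, mul_comm]
  have hM : ∑' k : ℤ, |u k| + n ^ 2 * ∑' k : ℤ, |u ((k + 1 : ℤ)) - 2 * u k + u ((k - 1 : ℤ))| ≤
      decayConst r * A * (n : ℝ) ^ (1 - r) := by
    have b1 : ∑' k : ℤ, |u k| ≤ A * ∑' k : ℤ, ((n : ℝ) + |(k : ℝ)|) ^ (-r) := by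
      rw [← tsum_mul_left]
      exact hsu.tsum_le_tsum (fun k => hu k) (hs.mul_left A)
    have b2 : n ^ 2 * ∑' k : ℤ, |u ((k + 1 : ℤ)) - 2 * u k + u ((k - 1 : ℤ))| ≤
        A * 2 ^ r * ∑' k : ℤ, ((n : ℝ) + |(k : ℝ)|) ^ (-r) := by
      rw [← tsum_mul_left, ← tsum_mul_left]
      refine Summable.tsum_le_tsum hd ?_ (hs.mul_left _)
      exact Summable.of_nonneg_of_le (fun _ => by positivity) hd (hs.mul_left _)
    calc _ ≤ (A + A * 2 ^ r) * ∑' k : ℤ, ((n : ℝ) + |(k : ℝ)|) ^ (-r) := by linarith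
      _ ≤ (A + A * 2 ^ r) * (2 * (2 ^ r / (r - 1)) * (n : ℝ) ^ (1 - r)) :=
          mul_le_mul_of_nonneg_left ht (by positivity)
      _ = _ := by unfold decayConst; ring
  refine (norm_trig_le_bump (a := fun k => u k) hsu hn hM x).trans (le_of_eq ?_)
  rw [sub_eq_neg_add, Real.rpow_add hn0, Real.rpow_one]
  field_simp

/-! ### Decay of a mask and its first two derivatives. -/

/-- The decay `t^{-r} (log (t+1))^{-κ}` of a mask of type `(r, κ)`. -/
def maskDecay (r κ t : ℝ) : ℝ := t ^ (-r) * Real.log (t + 1) ^ (-κ)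

lemma log_add_one_ge {t : ℝ} (ht : 1 / 2 ≤ t) : 1 / 3 ≤ Real.log (t + 1) := by
  have h : (3 / 2 : ℝ) ≤ t + 1 := by linarith
  have h1 := Real.one_sub_inv_le_log_of_pos (by norm_num : (0:ℝ) < 3 / 2)
  have h2 := Real.log_le_log (by norm_num) h
  norm_num at h1 ⊢
  linarith

lemma maskDecay_nonneg (r κ : ℝ) {t : ℝ} (ht : 0 ≤ t) : 0 ≤ maskDecay r κ t :=
  mul_nonneg (by positivity) (Real.rpow_nonneg (Real.log_nonneg (by linarith)) _)

lemma hasDerivAt_maskDecay (r κ : ℝ) {t : ℝ} (ht : 0 < t) :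
    HasDerivAt (maskDecay r κ)
      (maskDecay r κ t * (-r / t - κ / ((t + 1) * Real.log (t + 1)))) t := by
  have hL : 0 < Real.log (t + 1) := Real.log_pos (by linarith)
  have h1 := Real.hasDerivAt_rpow_const (x := t) (p := -r) (Or.inl ht.ne')
  have h2 : HasDerivAt (fun t : ℝ => Real.log (t + 1)) (1 / (t + 1)) t :=
    ((hasDerivAt_id t).add_const 1).log (by simp; linarith)
  have h3 := h2.rpow_const (p := -κ) (Or.inl hL.ne')
  refine (h1.mul h3).congr_deriv ?_
  rw [maskDecay, Real.rpow_sub_one ht.ne', Real.rpow_sub_one hL.ne']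
  field_simp
  ring

lemma hasDerivAt_logDeriv_maskDecay (r κ : ℝ) {t : ℝ} (ht : 0 < t) :
    HasDerivAt (fun t => -r / t - κ / ((t + 1) * Real.log (t + 1)))
      (r / t ^ 2 + κ * (Real.log (t + 1) + 1) / ((t + 1) * Real.log (t + 1)) ^ 2) t := by
  have hL : 0 < Real.log (t + 1) := Real.log_pos (by linarith)
  have h0 : HasDerivAt (fun t : ℝ => t + 1) 1 t := (hasDerivAt_id t).add_const 1
  have h2 : HasDerivAt (fun t : ℝ => Real.log (t + 1)) (1 / (t + 1)) t := h0.log (by linarith)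
  have h4 := (hasDerivAt_const t (-r)).div (hasDerivAt_id t) ht.ne'
  have h5 := (hasDerivAt_const t κ).div (h0.mul h2)
    (mul_ne_zero (by linarith) hL.ne')
  refine (h4.sub h5).congr_deriv ?_
  simp
  field_simp
  ring

/-- A mask in the logarithmic variable, with the decay removed. -/
def logProfile (r κ : ℝ) (lam : ℝ → ℝ) (s : ℝ) : ℝ :=
  lam (Real.exp s) * Real.exp (r * s) * Real.log (Real.exp s + 1) ^ κ

lemma log_exp_add_one_pos (s : ℝ) : 0 < Real.log (Real.exp s + 1) :=
  Real.log_pos (by linarith [Real.exp_pos s])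

lemma contDiff_logProfile (r κ : ℝ) {lam : ℝ → ℝ} (h : ContDiff ℝ 2 lam) :
    ContDiff ℝ 2 (logProfile r κ lam) := by
  unfold logProfile
  refine ContDiff.mul (ContDiff.mul (h.comp Real.contDiff_exp) (by fun_prop)) ?_
  refine ContDiff.rpow_const_of_ne ?_ fun s => (log_exp_add_one_pos s).ne'
  exact (Real.contDiff_exp.add contDiff_const).log fun s => by positivity

lemma eq_maskDecay_mul_logProfile (r κ : ℝ) (lam : ℝ → ℝ) {t : ℝ} (ht : 0 < t) :
    lam t = maskDecay r κ t * logProfile r κ lam (Real.log t) := by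
  have hL : 0 < Real.log (t + 1) := Real.log_pos (by linarith)
  rw [logProfile, Real.exp_log ht, maskDecay, mul_comm r, Real.exp_mul, Real.exp_log ht,
    Real.rpow_neg ht.le, Real.rpow_neg hL.le]
  have : t ^ r ≠ 0 := by positivity
  have : Real.log (t + 1) ^ κ ≠ 0 := by positivity
  field_simp

/-- For `s > 0` the profile coincides with `F`, which is controlled from `s = 1` on; on `[-1, 1]`
compactness suffices. The left end `-1` lies below `log (1/2)`, so all `t ≥ 1/2` are covered. -/
lemma exists_bound_logProfile {r κ : ℝ} {lam : ℝ → ℝ} (h : IsMask r κ lam) :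
    ∃ B : ℝ, ∀ s : ℝ, -1 ≤ s → ∀ k ∈ Finset.range 3,
      |iteratedDeriv k (logProfile r κ lam) s| ≤ B := by
  obtain ⟨-, hc, F, a, hF, ha⟩ := h
  have hG := contDiff_logProfile r κ hc
  have hcpt : ∀ k : ℕ, ∃ B : ℝ, k ≤ 2 →
      ∀ s ∈ Set.Icc (-1 : ℝ) 1, |iteratedDeriv k (logProfile r κ lam) s| ≤ B := by
    intro k
    by_cases hk : k ≤ 2
    · obtain ⟨B, hB⟩ := (isCompact_Icc (a := (-1 : ℝ)) (b := 1)).exists_bound_of_continuousOn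
        (hG.continuous_iteratedDeriv k (by exact_mod_cast hk)).continuousOn
      exact ⟨B, fun _ s hs => hB s hs⟩
    · exact ⟨0, fun h' => absurd h' hk⟩
  choose B hB using hcpt
  refine ⟨max a (max (B 0) (max (B 1) (B 2))), fun s hs k hk => ?_⟩
  have hk2 : k ≤ 2 := by simp at hk; omega
  rcases le_or_gt s 1 with h1 | h1
  · refine (hB k hk2 s ⟨hs, h1⟩).trans (le_max_of_le_right ?_)
    interval_cases k <;> simp
  · refine le_trans (le_of_eq ?_) ((ha s h1.le k hk).trans (le_max_left _ _))
    congr 1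
    refine Filter.EventuallyEq.iteratedDeriv_eq k ?_
    filter_upwards [lt_mem_nhds (by linarith : (0:ℝ) < s)] with t ht
    have h1t : 1 ≤ Real.exp t := Real.one_le_exp ht.le
    have hL := log_exp_add_one_pos t
    rw [logProfile, hF _ h1t, abs_of_pos (Real.exp_pos t), Real.log_exp, ← Real.exp_mul,
      Real.rpow_neg hL.le]
    have e : Real.exp (t * -r) * Real.exp (r * t) = 1 := by
      rw [← Real.exp_add, ← Real.exp_zero]; congr 1; ring
    have : Real.log (Real.exp t + 1) ^ κ ≠ 0 := by positivity
    calc Real.exp (t * -r) * (Real.log (Real.exp t + 1) ^ κ)⁻¹ * F t * Real.exp (r * t) *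
          Real.log (Real.exp t + 1) ^ κ = Real.exp (t * -r) * Real.exp (r * t) * F t *
          ((Real.log (Real.exp t + 1) ^ κ)⁻¹ * Real.log (Real.exp t + 1) ^ κ) := by ring
      _ = F t := by rw [e, inv_mul_cancel₀ this, one_mul, mul_one]

lemma ContDiff.hasDerivAt_deriv {u : ℝ → ℝ} (h : ContDiff ℝ 2 u) (t : ℝ) :
    HasDerivAt u (deriv u t) t ∧ HasDerivAt (deriv u) (deriv (deriv u) t) t := by
  refine ⟨(h.differentiable (by norm_num) t).hasDerivAt, ?_⟩
  have h1 : ContDiff ℝ 1 (deriv u) := by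
    have := (contDiff_succ_iff_deriv (n := 1) (f := u)).1 (by rwa [one_add_one_eq_two])
    exact this.2.2
  exact (h1.differentiable (by norm_num) t).hasDerivAt

/-- In the variable `s = log t` the operator `t d/dt` becomes `d/ds`. Writing `λ(t) = maskDecay(t)
G(log t)`, each derivative falls on the bounded profile `G` or brings down the logarithmic
derivative `g` of the decay; `t g` and `t² g'` are bounded. -/
lemma IsMask.exists_bound_of_pos {r κ : ℝ} (hr : 0 ≤ r) (hκ : 0 ≤ κ) {lam : ℝ → ℝ}
    (h : IsMask r κ lam) :
    ∃ B : ℝ, ∀ t : ℝ, 1 / 2 ≤ t → |lam t| ≤ B * maskDecay r κ t ∧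
      t * |deriv lam t| ≤ B * maskDecay r κ t ∧
      t ^ 2 * |deriv (deriv lam) t| ≤ B * maskDecay r κ t := by
  obtain ⟨B, hB⟩ := exists_bound_logProfile h
  have hB0 : 0 ≤ B := (abs_nonneg _).trans (hB 0 (by norm_num) 0 (by simp))
  have hlam := h.2.1
  set G := logProfile r κ lam with hGdef
  have hG := contDiff_logProfile r κ hlam
  -- `H` and `H'` bound `|t g|` and `|t² g'|` for `t ≥ 1/2`, where `1 / log (t+1) ≤ 3`; the 12 is `3
  -- + 3²`.
  set H : ℝ := r + 3 * κ with hH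
  set H' : ℝ := r + 12 * κ with hH'
  have hH0 : 0 ≤ H := by positivity
  have hH'0 : 0 ≤ H' := by positivity
  set g : ℝ → ℝ := fun t => -r / t - κ / ((t + 1) * Real.log (t + 1)) with hg
  set g' : ℝ → ℝ := fun t =>
    r / t ^ 2 + κ * (Real.log (t + 1) + 1) / ((t + 1) * Real.log (t + 1)) ^ 2 with hg'
  have d1 : ∀ t, 0 < t → HasDerivAt lam
      (maskDecay r κ t * (g t * G (Real.log t) + deriv G (Real.log t) / t)) t := by
    intro t ht
    have e1 := ((ContDiff.hasDerivAt_deriv hG (Real.log t)).1.comp t (Real.hasDerivAt_log ht.ne'))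
    have e2 := (hasDerivAt_maskDecay r κ ht).mul e1
    have e3 : lam =ᶠ[nhds t] (maskDecay r κ * (G ∘ Real.log)) := by
      filter_upwards [lt_mem_nhds ht] with y hy using eq_maskDecay_mul_logProfile r κ lam hy
    refine (e2.congr_of_eventuallyEq e3).congr_deriv ?_
    simp only [hg, Function.comp]
    ring
  have d2 : ∀ t, 0 < t → HasDerivAt (deriv lam)
      (maskDecay r κ t * (g t * (g t * G (Real.log t) + deriv G (Real.log t) / t) +
        (g' t * G (Real.log t) + g t * deriv G (Real.log t) / t +
          deriv (deriv G) (Real.log t) / t ^ 2 - deriv G (Real.log t) / t ^ 2))) t := by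
    intro t ht
    have e1 := ((ContDiff.hasDerivAt_deriv hG (Real.log t)).1.comp t (Real.hasDerivAt_log ht.ne'))
    have e1' := ((ContDiff.hasDerivAt_deriv hG (Real.log t)).2.comp t (Real.hasDerivAt_log ht.ne'))
    have e2 := (hasDerivAt_maskDecay r κ ht).mul
      (((hasDerivAt_logDeriv_maskDecay r κ ht).mul e1).add (e1'.div (hasDerivAt_id t) ht.ne'))
    have e3 : deriv lam =ᶠ[nhds t]
        fun t => maskDecay r κ t * (g t * G (Real.log t) + deriv G (Real.log t) / t) := by
      filter_upwards [lt_mem_nhds ht] with y hy using (d1 y hy).deriv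
    refine (e2.congr_of_eventuallyEq e3).congr_deriv ?_
    simp only [hg, hg', Function.comp, Pi.mul_apply, Pi.add_apply, Pi.div_apply, id]
    field_simp
    ring
  -- The second derivative has the six terms `α²x0`, `αx1` twice, `βx0`, `x2`, `-x1`, totalling `H²
  -- + 2H + H' + 2`.
  refine ⟨B * (H * (H + 1) + H' + H + 2), fun t ht => ?_⟩
  have ht0 : 0 < t := by linarith
  have hm := maskDecay_nonneg r κ ht0.le
  have hs : -1 ≤ Real.log t := by
    have := Real.one_sub_inv_le_log_of_pos ht0
    have h2 : t⁻¹ ≤ 2 := by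
      rw [inv_le_comm₀ ht0 (by norm_num)]; linarith
    linarith
  have b0 : |G (Real.log t)| ≤ B := by simpa using hB _ hs 0 (by simp)
  have b1 : |deriv G (Real.log t)| ≤ B := by
    have := hB _ hs 1 (by simp)
    rwa [iteratedDeriv_one] at this
  have b2 : |deriv (deriv G) (Real.log t)| ≤ B := by
    have := hB _ hs 2 (by simp)
    rwa [iteratedDeriv_succ, iteratedDeriv_one] at this
  have hL := log_add_one_ge ht
  have hL0 : 0 < Real.log (t + 1) := by linarith
  set x0 := G (Real.log t)
  set x1 := deriv G (Real.log t)
  set x2 := deriv (deriv G) (Real.log t)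
  set α := t * g t with hα
  set β := t ^ 2 * g' t with hβ
  have hLinv : (Real.log (t + 1))⁻¹ ≤ 3 := by
    rw [inv_le_comm₀ hL0 (by norm_num)]; linarith
  have hti : t / (t + 1) ≤ 1 := by rw [div_le_one (by linarith)]; linarith
  have hti0 : 0 ≤ t / (t + 1) := by positivity
  have hαb : |α| ≤ H := by
    have e : α = -(r + κ * (t / (t + 1)) * (Real.log (t + 1))⁻¹) := by
      simp only [hα, hg]; field_simp; ring
    rw [e, abs_neg, abs_of_nonneg (by positivity), hH]
    have : κ * (t / (t + 1)) * (Real.log (t + 1))⁻¹ ≤ κ * 1 * 3 := by gcongr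
    linarith
  have hβb : |β| ≤ H' := by
    have e : β = r + κ * (t / (t + 1)) ^ 2 *
        ((Real.log (t + 1))⁻¹ + (Real.log (t + 1))⁻¹ ^ 2) := by
      simp only [hβ, hg']; field_simp
    rw [e, abs_of_nonneg (by positivity), hH']
    have : κ * (t / (t + 1)) ^ 2 * ((Real.log (t + 1))⁻¹ + (Real.log (t + 1))⁻¹ ^ 2) ≤
        κ * 1 ^ 2 * (3 + 3 ^ 2) := by gcongr
    linarith
  have c1 : |α * x0| ≤ H * B := by rw [abs_mul]; gcongr
  have c2 : |α * x1| ≤ H * B := by rw [abs_mul]; gcongr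
  have c3 : |β * x0| ≤ H' * B := by rw [abs_mul]; gcongr
  have c4 : |α * (α * x0)| ≤ H * (H * B) := by rw [abs_mul]; gcongr
  have hHB : 0 ≤ H * B := by positivity
  have hH'B : 0 ≤ H' * B := by positivity
  have hHHB : 0 ≤ H * (H * B) := by positivity
  rw [abs_le] at b0 b1 b2 c1 c2 c3 c4
  refine ⟨?_, ?_, ?_⟩
  · rw [eq_maskDecay_mul_logProfile r κ lam ht0, abs_mul, abs_of_nonneg hm, mul_comm]
    gcongr
    rw [abs_le]
    constructor <;> linarith
  · have e : t * |deriv lam t| = |α * x0 + x1| * maskDecay r κ t := by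
      rw [(d1 t ht0).deriv, abs_mul, abs_of_nonneg hm]
      have : t * |g t * x0 + x1 / t| = |α * x0 + x1| := by
        rw [← abs_of_pos ht0, ← abs_mul, abs_of_pos ht0]
        congr 1; simp only [hα]; field_simp
      rw [← this]; ring
    rw [e]
    gcongr
    rw [abs_le]
    constructor <;> linarith
  · have e : t ^ 2 * |deriv (deriv lam) t| =
        |α * (α * x0) + α * x1 + β * x0 + α * x1 + x2 - x1| * maskDecay r κ t := by
      rw [(d2 t ht0).deriv, abs_mul, abs_of_nonneg hm]
      have : t ^ 2 * |g t * (g t * x0 + x1 / t) + (g' t * x0 + g t * x1 / t + x2 / t ^ 2 -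
          x1 / t ^ 2)| = |α * (α * x0) + α * x1 + β * x0 + α * x1 + x2 - x1| := by
        rw [← abs_of_pos (by positivity : 0 < t ^ 2), ← abs_mul,
          abs_of_pos (by positivity : 0 < t ^ 2)]
        congr 1; simp only [hα, hβ]; field_simp; ring
      rw [← this]; ring
    rw [e]
    gcongr
    rw [abs_le]
    constructor <;> linarith

lemma deriv_even {u : ℝ → ℝ} (h : ∀ t, u (-t) = u t) (t : ℝ) : deriv u (-t) = -deriv u t := by
  have : deriv u t = deriv (fun t => u (-t)) t := by simp_rw [h]
  rw [this, deriv_comp_neg, neg_neg]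

lemma deriv_odd {u : ℝ → ℝ} (h : ∀ t, u (-t) = -u t) (t : ℝ) : deriv u (-t) = deriv u t := by
  have : deriv (fun t => -u t) t = deriv (fun t => u (-t)) t := by simp_rw [h]
  rw [deriv_comp_neg, deriv.fun_neg] at this
  linarith

lemma IsMask.exists_bound {r κ : ℝ} (hr : 0 ≤ r) (hκ : 0 ≤ κ) {lam : ℝ → ℝ}
    (h : IsMask r κ lam) :
    ∃ B : ℝ, 0 ≤ B ∧ ∀ t : ℝ, 1 / 2 ≤ |t| → |lam t| ≤ B * maskDecay r κ |t| ∧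
      |t| * |deriv lam t| ≤ B * maskDecay r κ |t| ∧
      |t| ^ 2 * |deriv (deriv lam) t| ≤ B * maskDecay r κ |t| := by
  obtain ⟨B, hB⟩ := h.exists_bound_of_pos hr hκ
  refine ⟨max B 0, le_max_right _ _, fun t ht => ?_⟩
  have hm : B * maskDecay r κ |t| ≤ max B 0 * maskDecay r κ |t| :=
    mul_le_mul_of_nonneg_right (le_max_left _ _) (maskDecay_nonneg r κ (abs_nonneg t))
  obtain ⟨h1, h2, h3⟩ := hB |t| ht
  have e1 := deriv_even h.1
  have e2 := deriv_odd e1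
  rcases abs_choice t with h' | h' <;> rw [h'] at h1 h2 h3 hm ⊢
  · exact ⟨h1.trans hm, h2.trans hm, h3.trans hm⟩
  · rw [h.1] at h1
    rw [e1, abs_neg] at h2
    rw [e2] at h3
    exact ⟨h1.trans hm, h2.trans hm, h3.trans hm⟩

/-! ### Cut-off functions and the high-pass and low-pass kernels. -/

/-- The univariate error rate `n^{-r} (log (n/2+1))^{-κ}`. -/
def rate (r κ : ℝ) (n : ℕ) : ℝ := (n : ℝ) ^ (-r) * Real.log ((n : ℝ) / 2 + 1) ^ (-κ)

lemma rate_nonneg (r κ : ℝ) (n : ℕ) : 0 ≤ rate r κ n :=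
  mul_nonneg (by positivity) (Real.rpow_nonneg (Real.log_nonneg (by linarith [(Nat.cast_nonneg n : (0:ℝ) ≤ n)])) _)

lemma deriv_eq_zero_of_eqOn {u : ℝ → ℝ} {c : ℝ} {s : Set ℝ} (hs : IsOpen s)
    (h : ∀ x ∈ s, u x = c) {x : ℝ} (hx : x ∈ s) : deriv u x = 0 ∧ deriv (deriv u) x = 0 := by
  have h1 : ∀ x ∈ s, deriv u x = 0 := fun x hx => by
    have : u =ᶠ[nhds x] fun _ => c := by filter_upwards [hs.mem_nhds hx] with y hy using h y hy
    rw [this.deriv_eq, deriv_const]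
  refine ⟨h1 x hx, ?_⟩
  have : deriv u =ᶠ[nhds x] fun _ => 0 := by filter_upwards [hs.mem_nhds hx] with y hy using h1 y hy
  rw [this.deriv_eq, deriv_const]

lemma IsCutoff.eq_zero {ϑ : ℝ → ℝ} (h : IsCutoff ϑ) {x : ℝ} (hx : 1 ≤ |x|) : ϑ x = 0 := by
  refine h.2.2 x fun hm => ?_
  rw [Set.mem_Ioo, ← abs_lt] at hm
  linarith

lemma IsCutoff.deriv_eq_zero {ϑ : ℝ → ℝ} (h : IsCutoff ϑ) {x : ℝ} (hx : 1 < |x|) :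
    deriv ϑ x = 0 ∧ deriv (deriv ϑ) x = 0 :=
  deriv_eq_zero_of_eqOn (s := {x | 1 < |x|}) (isOpen_lt continuous_const continuous_abs)
    (fun _ hx => h.eq_zero (le_of_lt hx)) hx

lemma IsCutoff.sq {ϑ : ℝ → ℝ} (h : IsCutoff ϑ) : IsCutoff fun t => ϑ t ^ 2 :=
  ⟨h.1.pow 2, fun x hx => by simp [h.2.1 x hx], fun x hx => by simp [h.2.2 x hx]⟩

lemma IsCutoff.exists_bound {ϑ : ℝ → ℝ} (h : IsCutoff ϑ) :
    ∃ B : ℝ, 0 ≤ B ∧ ∀ x, |ϑ x| ≤ B ∧ |deriv ϑ x| ≤ B ∧ |deriv (deriv ϑ) x| ≤ B := by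
  have c1 : ContDiff ℝ 1 (deriv ϑ) :=
    ((contDiff_succ_iff_deriv (n := 1) (f := ϑ)).1 (by rw [one_add_one_eq_two]; exact h.1)).2.2
  have c2 : Continuous (deriv (deriv ϑ)) :=
    ((contDiff_succ_iff_deriv (n := 0) (f := deriv ϑ)).1 (by rwa [zero_add])).2.2.continuous
  have hb : ∀ u : ℝ → ℝ, Continuous u → ∃ B : ℝ, ∀ x ∈ Set.Icc (-1 : ℝ) 1, |u x| ≤ B := fun u hu =>
    isCompact_Icc.exists_bound_of_continuousOn hu.continuousOn
  obtain ⟨B0, h0⟩ := hb _ h.1.continuous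
  obtain ⟨B1, h1⟩ := hb _ c1.continuous
  obtain ⟨B2, h2⟩ := hb _ c2
  refine ⟨|B0| + |B1| + |B2|, by positivity, fun x => ?_⟩
  have a0 := le_abs_self B0
  have a1 := le_abs_self B1
  have a2 := le_abs_self B2
  have n0 := abs_nonneg B0
  have n1 := abs_nonneg B1
  have n2 := abs_nonneg B2
  rcases le_or_gt |x| 1 with hx | hx
  · have hx' := Set.mem_Icc.2 (abs_le.1 hx)
    exact ⟨by linarith [h0 x hx'], by linarith [h1 x hx'], by linarith [h2 x hx']⟩
  · rw [h.eq_zero hx.le, (h.deriv_eq_zero hx).1, (h.deriv_eq_zero hx).2, abs_zero]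
    have : 0 ≤ |B0| + |B1| + |B2| := by positivity
    exact ⟨this, this, this⟩

lemma abs_div_natCast (t : ℝ) (n : ℕ) : |t / n| = |t| / n := by
  rw [abs_div, Nat.abs_cast]

/-- For `t ≥ n/2` one has `n + t ≤ 3t`, and the logarithm is replaced by its value at the endpoint
`n/2`. -/
lemma maskDecay_le {r κ : ℝ} (hr : 0 ≤ r) (hκ : 0 ≤ κ) {n : ℕ} (hn : 1 ≤ n) {t : ℝ}
    (ht : (n : ℝ) / 2 ≤ t) :
    maskDecay r κ t ≤ 3 ^ r * Real.log ((n : ℝ) / 2 + 1) ^ (-κ) * (n + t) ^ (-r) := by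
  have hn' : (1 : ℝ) ≤ n := by exact_mod_cast hn
  have hL := log_add_one_ge (by linarith : 1 / 2 ≤ (n : ℝ) / 2)
  have ht0 : 0 < t := by linarith
  have h1 : t ^ (-r) ≤ 3 ^ r * (n + t) ^ (-r) := by
    calc t ^ (-r) ≤ ((n + t) / 3) ^ (-r) :=
          Real.rpow_le_rpow_of_nonpos (by positivity) (by linarith) (by linarith)
      _ = _ := by
          rw [Real.div_rpow (by positivity) (by norm_num), Real.rpow_neg (by norm_num : (0:ℝ) ≤ 3),
            div_inv_eq_mul, mul_comm]
  have h2 : Real.log (t + 1) ^ (-κ) ≤ Real.log ((n : ℝ) / 2 + 1) ^ (-κ) :=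
    Real.rpow_le_rpow_of_nonpos (by linarith)
      (Real.log_le_log (by positivity) (by linarith)) (by linarith)
  have hLk : 0 ≤ Real.log (t + 1) ^ (-κ) := Real.rpow_nonneg (Real.log_nonneg (by linarith)) _
  calc maskDecay r κ t ≤ (3 ^ r * (n + t) ^ (-r)) * Real.log ((n : ℝ) / 2 + 1) ^ (-κ) := by
        unfold maskDecay; gcongr
    _ = _ := by ring

lemma hasDerivAt_comp_div_natCast {u : ℝ → ℝ} {u' t : ℝ} (n : ℕ) (h : HasDerivAt u u' (t / n)) :
    HasDerivAt (fun t => u (t / n)) (u' / n) t := by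
  have := h.comp t ((hasDerivAt_id t).div_const (n : ℝ))
  simpa [Function.comp_def, div_eq_mul_inv] using this

/-- Cutting off the low frequencies of a mask leaves a small kernel. -/
lemma exists_highpass_bound {r κ : ℝ} (hr : 1 < r) (hκ : 0 ≤ κ) {lam : ℝ → ℝ}
    (h : IsMask r κ lam) {ϑ : ℝ → ℝ} (hϑ : IsCutoff ϑ) :
    ∃ C : ℝ, 0 ≤ C ∧ ∀ n : ℕ, 1 ≤ n → (Summable fun k : ℤ => |(1 - ϑ (k / n)) * lam k|) ∧
      ∀ x, ‖trig (fun k => (1 - ϑ (k / n)) * lam k) x‖ ≤ C * rate r κ n * bump n x := by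
  obtain ⟨B, hB0, hB⟩ := h.exists_bound (by linarith) hκ
  obtain ⟨D, hD0, hD⟩ := hϑ.exists_bound
  have hc := decayConst_nonneg hr
  -- On the support `n ≤ 2|t|`, so the three terms of `n² u''` are at most `D`, `2 · 2D` and
  -- `4(1+D)` times the mask bound, hence `9(1+D)` in all; `3^r` comes from `maskDecay_le`.
  refine ⟨decayConst r * (9 * (1 + D) * B * 3 ^ r), by positivity, fun n hn => ?_⟩
  have hn1 : (1 : ℝ) ≤ n := by exact_mod_cast hn
  set A : ℝ := 9 * (1 + D) * B * 3 ^ r * Real.log ((n : ℝ) / 2 + 1) ^ (-κ) with hA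
  have hlog : 0 ≤ Real.log ((n : ℝ) / 2 + 1) ^ (-κ) :=
    Real.rpow_nonneg (Real.log_nonneg (by linarith)) _
  have hA0 : 0 ≤ A := by positivity
  have hm : ∀ t : ℝ, (n : ℝ) / 2 ≤ |t| →
      9 * (1 + D) * (B * maskDecay r κ |t|) ≤ A * (n + |t|) ^ (-r) := fun t ht => by
    calc _ ≤ 9 * (1 + D) * (B * (3 ^ r * Real.log ((n : ℝ) / 2 + 1) ^ (-κ) * (n + |t|) ^ (-r))) := by
          gcongr; exact maskDecay_le (by linarith) hκ hn ht
      _ = _ := by rw [hA]; ring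
  set u : ℝ → ℝ := fun t => (1 - ϑ (t / n)) * lam t with hu
  set u' : ℝ → ℝ := fun t => -(deriv ϑ (t / n) / n) * lam t + (1 - ϑ (t / n)) * deriv lam t with hu'
  set u'' : ℝ → ℝ := fun t => -(deriv (deriv ϑ) (t / n) / n / n) * lam t +
    -(deriv ϑ (t / n) / n) * deriv lam t +
    (-(deriv ϑ (t / n) / n) * deriv lam t + (1 - ϑ (t / n)) * deriv (deriv lam) t) with hu''
  have h1 : ∀ t, HasDerivAt u (u' t) t := fun t => by
    have e := hasDerivAt_comp_div_natCast n (ContDiff.hasDerivAt_deriv hϑ.1 (t / n)).1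
    exact (e.const_sub 1).mul (ContDiff.hasDerivAt_deriv h.2.1 t).1
  have h2 : ∀ t, HasDerivAt u' (u'' t) t := fun t => by
    have e := hasDerivAt_comp_div_natCast n (ContDiff.hasDerivAt_deriv hϑ.1 (t / n)).1
    have e' := hasDerivAt_comp_div_natCast n (ContDiff.hasDerivAt_deriv hϑ.1 (t / n)).2
    obtain ⟨l1, l2⟩ := ContDiff.hasDerivAt_deriv h.2.1 t
    exact ((e'.div_const (n : ℝ)).neg.mul l1).add ((e.const_sub 1).mul l2)
  have hlow : ∀ t : ℝ, |t| < n / 2 → u t = 0 ∧ u'' t = 0 := fun t ht => by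
    have hx : |t / n| < 1 / 2 := by
      rw [abs_div_natCast, div_lt_iff₀ (by positivity)]; linarith
    have hx' : t / n ∈ Set.Ioo (-(1 / 2) : ℝ) (1 / 2) := Set.mem_Ioo.2 (abs_lt.1 hx)
    have hd := deriv_eq_zero_of_eqOn isOpen_Ioo
      (fun x hx => hϑ.2.1 x (Set.Ioo_subset_Icc_self hx)) hx'
    have h1' := hϑ.2.1 _ (Set.Ioo_subset_Icc_self hx')
    constructor
    · simp only [hu, h1', sub_self, zero_mul]
    · simp only [hu'', h1', hd.1, hd.2]; simp
  have hub : ∀ t, |u t| ≤ A * (n + |t|) ^ (-r) := fun t => by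
    rcases lt_or_ge |t| (n / 2) with ht | ht
    · rw [(hlow t ht).1, abs_zero]; positivity
    · refine le_trans ?_ (hm t ht)
      obtain ⟨b0, -, -⟩ := hB t (by linarith)
      have a0 : |1 - ϑ (t / n)| ≤ 1 + D :=
        (abs_sub _ _).trans (by rw [abs_one]; linarith [(hD (t / n)).1])
      calc |u t| ≤ (1 + D) * (B * maskDecay r κ |t|) := by
            simp only [hu]; rw [abs_mul]; gcongr
        _ ≤ _ := by
            have : 0 ≤ (1 + D) * (B * maskDecay r κ |t|) := by
              have := maskDecay_nonneg r κ (abs_nonneg t); positivity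
            linarith
  have hub'' : ∀ t, n ^ 2 * |u'' t| ≤ A * (n + |t|) ^ (-r) := fun t => by
    rcases lt_or_ge |t| (n / 2) with ht | ht
    · rw [(hlow t ht).2, abs_zero]; simp only [mul_zero]; positivity
    · refine le_trans ?_ (hm t ht)
      obtain ⟨b0, b1, b2⟩ := hB t (by linarith)
      obtain ⟨d0, d1, d2⟩ := hD (t / n)
      have a0 : |1 - ϑ (t / n)| ≤ 1 + D := (abs_sub _ _).trans (by rw [abs_one]; linarith)
      set M := B * maskDecay r κ |t|
      have hM : 0 ≤ M := (abs_nonneg _).trans b0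
      have e : n ^ 2 * |u'' t| = |-(deriv (deriv ϑ) (t / n) * lam t) +
          -(2 * (deriv ϑ (t / n) * (n * deriv lam t))) +
          (1 - ϑ (t / n)) * (n ^ 2 * deriv (deriv lam) t)| := by
        rw [← abs_of_nonneg (by positivity : (0:ℝ) ≤ (n:ℝ) ^ 2), ← abs_mul,
          abs_of_nonneg (by positivity : (0:ℝ) ≤ (n:ℝ) ^ 2)]
        congr 1
        simp only [hu'']
        field_simp
        ring
      have c1 : |n * deriv lam t| ≤ 2 * M := by
        rw [abs_mul, Nat.abs_cast]
        calc (n : ℝ) * |deriv lam t| ≤ (2 * |t|) * |deriv lam t| := by gcongr; linarith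
          _ ≤ _ := by linarith
      have c2 : |n ^ 2 * deriv (deriv lam) t| ≤ 4 * M := by
        rw [abs_mul, abs_of_nonneg (by positivity : (0:ℝ) ≤ (n:ℝ) ^ 2)]
        calc (n : ℝ) ^ 2 * |deriv (deriv lam) t| ≤ (2 * |t|) ^ 2 * |deriv (deriv lam) t| := by
              gcongr; linarith
          _ ≤ _ := by nlinarith
      have f0 : |deriv (deriv ϑ) (t / n) * lam t| ≤ D * M := by rw [abs_mul]; gcongr
      have f1 : |deriv ϑ (t / n) * (n * deriv lam t)| ≤ D * (2 * M) := by rw [abs_mul]; gcongr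
      have f2 : |(1 - ϑ (t / n)) * (n ^ 2 * deriv (deriv lam) t)| ≤ (1 + D) * (4 * M) := by
        rw [abs_mul]; gcongr
      rw [e]
      have hDM : 0 ≤ D * M := by positivity
      rw [abs_le] at f0 f1 f2 ⊢
      constructor <;> linarith
  refine ⟨summable_of_decay hr hn hub, fun x => ?_⟩
  refine (norm_trig_le_of_decay hr hn h1 h2 hub hub'' x).trans (le_of_eq ?_)
  rw [hA, rate]; ring

/-- The kernel with multiplier `ϑ(k/n)` is localized at scale `1/n`. -/
lemma exists_lowpass_bound {ϑ : ℝ → ℝ} (hϑ : IsCutoff ϑ) :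
    ∃ C : ℝ, 0 ≤ C ∧ ∀ n : ℕ, 1 ≤ n → ∀ x, ‖trig (fun k => ϑ (k / n)) x‖ ≤ C * bump n x := by
  obtain ⟨D, hD0, hD⟩ := hϑ.exists_bound
  -- The multiplier is supported in `|t| ≤ n`, where `4n² (n+|t|)^{-2} ≥ 1`, so the decay exponent 2
  -- is available.
  have hr : (1 : ℝ) < 2 := by norm_num
  have hc := decayConst_nonneg hr
  refine ⟨decayConst 2 * (D * 4), by positivity, fun n hn x => ?_⟩
  have hn1 : (1 : ℝ) ≤ n := by exact_mod_cast hn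
  have key : ∀ t y : ℝ, |y| ≤ D → (n < |t| → y = 0) →
      |y| ≤ D * 4 * n ^ 2 * (n + |t|) ^ (-2 : ℝ) := fun t y hy h0 => by
    rcases le_or_gt |t| n with ht | ht
    · refine hy.trans ?_
      rw [Real.rpow_neg (by positivity), Real.rpow_two, ← div_eq_mul_inv, le_div_iff₀ (by positivity)]
      have : (n + |t|) ^ 2 ≤ (2 * n) ^ 2 := by gcongr; linarith
      calc D * (n + |t|) ^ 2 ≤ D * (2 * n) ^ 2 := by gcongr
        _ = _ := by ring
    · rw [h0 ht, abs_zero]; positivity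
  have habs : ∀ t : ℝ, n < |t| → 1 < |t / n| := fun t ht => by
    rwa [abs_div_natCast, one_lt_div (by positivity)]
  refine (norm_trig_le_of_decay (u := fun t => ϑ (t / n)) (u' := fun t => deriv ϑ (t / n) / n)
    (u'' := fun t => deriv (deriv ϑ) (t / n) / n / n) (A := D * 4 * n ^ 2) hr hn
    (fun t => hasDerivAt_comp_div_natCast n (ContDiff.hasDerivAt_deriv hϑ.1 (t / n)).1)
    (fun t => (hasDerivAt_comp_div_natCast n
      (ContDiff.hasDerivAt_deriv hϑ.1 (t / n)).2).div_const _) (fun t => ?_) (fun t => ?_) x).trans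
    (le_of_eq ?_)
  · exact key t _ (hD _).1 fun ht => hϑ.eq_zero (habs t ht).le
  · have e : n ^ 2 * |deriv (deriv ϑ) (t / n) / n / n| = |deriv (deriv ϑ) (t / n)| := by
      rw [abs_div, abs_div, Nat.abs_cast]; field_simp
    rw [e]
    exact key t _ (hD _).2.2 fun ht => (hϑ.deriv_eq_zero (habs t ht)).2
  · rw [Real.rpow_neg (by positivity), Real.rpow_two]
    field_simp

/-! ### Exact quadrature on the grid and the error kernel of `Q_n`. -/

lemma trig_eq_sum {h : ℤ → ℝ} {n : ℕ} (hh : ∀ k : ℤ, (n : ℤ) < |k| → h k = 0) (x : Circ) :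
    trig h x = ∑ k ∈ Finset.Icc (-n : ℤ) n, (h k : ℂ) * fourier k x := by
  refine tsum_eq_sum fun k hk => ?_
  rw [hh k, Complex.ofReal_zero, zero_mul]
  by_contra! hc
  exact hk (Finset.mem_Icc.2 (abs_le.1 hc))

/-- Two frequencies in `[-n, n]` differ by less than `2n+1`, so there is no aliasing. -/
lemma sum_fourier_gridPt (n : ℕ) {k l : ℤ} (hk : k ∈ Finset.Icc (-n : ℤ) n)
    (hl : l ∈ Finset.Icc (-n : ℤ) n) :
    ∑ s ∈ Finset.range (2 * n + 1), fourier k (gridPt n s) * fourier (-l) (gridPt n s) =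
      if k = l then (2 * n + 1 : ℂ) else 0 := by
  simp_rw [← fourier_add, fourier_gridPt]
  split_ifs with h
  · subst h; simp
  · refine sum_gridRoot_pow n _ fun hd => h ?_
    rw [Finset.mem_Icc] at hk hl
    have := Int.eq_zero_of_abs_lt_dvd hd (by rw [abs_lt]; push_cast; constructor <;> omega)
    omega

lemma mean_trig_mul_trig {h v : ℤ → ℝ} {n : ℕ} (hh : ∀ k : ℤ, (n : ℤ) < |k| → h k = 0)
    (hv : ∀ k : ℤ, (n : ℤ) < |k| → v k = 0) (x y : Circ) :
    (2 * (n : ℂ) + 1)⁻¹ * ∑ s ∈ Finset.range (2 * n + 1),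
      trig h (gridPt n s - y) * trig v (x - gridPt n s) = trig (fun k => h k * v k) (x - y) := by
  have hN : (2 * (n : ℂ) + 1) ≠ 0 := by exact_mod_cast (by omega : 2 * n + 1 ≠ 0)
  have e : ∀ s, trig h (gridPt n s - y) * trig v (x - gridPt n s) =
      ∑ k ∈ Finset.Icc (-n : ℤ) n, ∑ l ∈ Finset.Icc (-n : ℤ) n,
        ((h k : ℂ) * fourier (-k) y * ((v l : ℂ) * fourier l x)) *
          (fourier k (gridPt n s) * fourier (-l) (gridPt n s)) := fun s => by
    rw [trig_eq_sum hh, trig_eq_sum hv, Finset.sum_mul_sum]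
    refine Finset.sum_congr rfl fun k _ => Finset.sum_congr rfl fun l _ => ?_
    rw [fourier_sub_apply, fourier_sub_apply]; ring
  simp_rw [e]
  rw [Finset.sum_comm, trig_eq_sum (n := n) (fun k hk => by rw [hh k hk, zero_mul]),
    Finset.mul_sum]
  refine Finset.sum_congr rfl fun k hk => ?_
  rw [Finset.sum_comm]
  simp_rw [← Finset.mul_sum]
  rw [Finset.sum_eq_single k]
  · rw [sum_fourier_gridPt n hk hk, if_pos rfl, fourier_sub_apply]
    push_cast
    field_simp
  · intro l hl hlk
    rw [sum_fourier_gridPt n hk hl, if_neg hlk.symm, mul_zero]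
  · exact fun h' => absurd hk h'

lemma IsCutoff.eq_zero_int {ϑ : ℝ → ℝ} (h : IsCutoff ϑ) {n : ℕ} (hn : 1 ≤ n) {k : ℤ}
    (hk : (n : ℤ) ≤ |k|) : ϑ (k / n) = 0 := by
  refine h.eq_zero ?_
  have hn0 : (0 : ℝ) < n := by exact_mod_cast hn
  rw [abs_div_natCast, le_div_iff₀ hn0, one_mul]
  exact_mod_cast hk

lemma IsCutoff.summable {ϑ : ℝ → ℝ} (h : IsCutoff ϑ) {n : ℕ} (hn : 1 ≤ n) (a : ℤ → ℝ) :
    Summable fun k : ℤ => |ϑ (k / n) * a k| := by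
  refine summable_of_hasFiniteSupport ((Finset.Icc (-n : ℤ) n).finite_toSet.subset fun k hk => ?_)
  by_contra hc
  refine hk ?_
  simp only
  rw [h.eq_zero_int hn, zero_mul, abs_zero]
  by_contra! h'
  exact hc (Finset.mem_coe.2 (Finset.mem_Icc.2 (abs_le.1 h'.le)))

/-- The kernel of the sampling operator `φ * g ↦ Q_n (φ * g)`. -/
def sampleKer (ϑ lam : ℝ → ℝ) (n : ℕ) (x y : Circ) : ℂ :=
  (2 * (n : ℂ) + 1)⁻¹ * ∑ s ∈ Finset.range (2 * n + 1),
    trig (fun k => ϑ (k / n)) (gridPt n s - y) * trig (fun k => lam k) (x - gridPt n s)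

/-- The sampled copy of `φ_λ` is split by `λ = ϑλ + (1-ϑ)λ`. The low part has degree at most `n` and
is averaged exactly, giving the multiplier `ϑ²λ`; both remaining terms involve only frequencies
beyond `n/2`. -/
lemma phi_sub_sampleKer {ϑ lam : ℝ → ℝ} (hϑ : IsCutoff ϑ) {n : ℕ} (hn : 1 ≤ n)
    (hs : Summable fun k : ℤ => |lam k|) (x y : Circ) :
    trig (fun k => lam k) (x - y) - sampleKer ϑ lam n x y =
      trig (fun k => (1 - ϑ (k / n) ^ 2) * lam k) (x - y) -
      (2 * (n : ℂ) + 1)⁻¹ * ∑ s ∈ Finset.range (2 * n + 1),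
        trig (fun k => ϑ (k / n)) (gridPt n s - y) *
          trig (fun k => (1 - ϑ (k / n)) * lam k) (x - gridPt n s) := by
  have hz : ∀ k : ℤ, (n : ℤ) < |k| → ϑ (k / n) = 0 := fun k hk => hϑ.eq_zero_int hn hk.le
  have e1 := mean_trig_mul_trig (h := fun k => ϑ (k / n)) (v := fun k => ϑ (k / n) * lam k)
    hz (fun k hk => by simp only [hz k hk, zero_mul]) x y
  have e2 : ∀ z, trig (fun k => (1 - ϑ (k / n)) * lam k) z =
      trig (fun k => lam k) z - trig (fun k => ϑ (k / n) * lam k) z := fun z => by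
    rw [← trig_sub hs (hϑ.summable hn _)]
    congr 1; ext k; ring
  have e3 : ∀ z, trig (fun k => (1 - ϑ (k / n) ^ 2) * lam k) z =
      trig (fun k => lam k) z - trig (fun k => ϑ (k / n) * (ϑ (k / n) * lam k)) z := fun z => by
    rw [← trig_sub hs (hϑ.summable hn _)]
    congr 1; ext k; ring
  simp_rw [e2, e3, mul_sub, Finset.sum_sub_distrib]
  rw [mul_sub, e1, sampleKer]
  ring

/-- At scale `n = 1` the mask is a summable high-pass part plus a finitely supported one. -/
lemma IsMask.summable {r κ : ℝ} (hr : 1 < r) (hκ : 0 ≤ κ) {lam : ℝ → ℝ} (h : IsMask r κ lam)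
    {ϑ : ℝ → ℝ} (hϑ : IsCutoff ϑ) : Summable fun k : ℤ => |lam k| := by
  obtain ⟨C, -, hC⟩ := exists_highpass_bound hr hκ h hϑ
  refine Summable.of_nonneg_of_le (fun _ => abs_nonneg _) (fun k => ?_)
    ((hC 1 le_rfl).1.add (hϑ.summable le_rfl fun k => lam k))
  refine le_trans (le_of_eq ?_) (abs_add_le _ _)
  congr 1; ring

/-- The kernel bound for a product of two localized kernels sampled on the grid. -/
def bumpMean (n : ℕ) (x y : Circ) : ℝ :=
  (2 * (n : ℝ) + 1)⁻¹ * ∑ s ∈ Finset.range (2 * n + 1), bump n (gridPt n s - y) * bump n (x - gridPt n s)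

lemma bumpMean_comm (n : ℕ) (x y : Circ) : bumpMean n x y = bumpMean n y x := by
  unfold bumpMean
  congr 1
  refine Finset.sum_congr rfl fun s _ => ?_
  rw [bump_sub_comm n _ y, bump_sub_comm n x, mul_comm]

lemma integrable_of_continuous {u : Circ → ℝ} (hu : Continuous u) : Integrable u circMeasure :=
  hu.integrable_of_hasCompactSupport (HasCompactSupport.of_compactSpace _)

lemma continuous_bumpMean (n : ℕ) (x : Circ) : Continuous fun y => bumpMean n x y := by
  have := continuous_bump n
  unfold bumpMean
  fun_prop

/-- Integration in `y` removes one bump at the cost 3; the grid mean of the other costs another 3.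
-/
lemma integral_bumpMean_le {n : ℕ} (hn : 1 ≤ n) (x : Circ) :
    ∫ y, bumpMean n x y ∂circMeasure ≤ 9 := by
  have hb := continuous_bump n
  unfold bumpMean
  rw [integral_const_mul, integral_finsetSum _ fun s _ => integrable_of_continuous (by fun_prop)]
  simp_rw [integral_mul_const, integral_sub_left_eq_self (bump n) circMeasure]
  rw [← Finset.mul_sum]
  have h1 := integral_bump_le n hn
  have h2 := mean_bump_le n hn x
  have h3 : 0 ≤ ∫ y, bump n y ∂circMeasure := integral_nonneg fun y => bump_nonneg n y
  simp_rw [bump_sub_comm n x]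
  calc _ = (∫ y, bump n y ∂circMeasure) * ((2 * n + 1 : ℝ)⁻¹ *
        ∑ s ∈ Finset.range (2 * n + 1), bump n (gridPt n s - x)) := by ring
    _ ≤ 3 * 3 := mul_le_mul h1 h2 (mul_nonneg (by positivity)
        (Finset.sum_nonneg fun s _ => bump_nonneg _ _)) (by norm_num)
    _ = 9 := by norm_num

/-! ### Calculus of Schur bounds and the univariate error estimate. -/

/-- A continuous kernel with `L^1` norms in each variable bounded by `R`. -/
structure SchurBound {X : Type*} [TopologicalSpace X] [MeasurableSpace X] (μ : Measure X)
    (B : X → X → ℂ) (R : ℝ≥0∞) : Prop where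
  cont : Continuous (Function.uncurry B)
  left : ∀ x, ∫⁻ y, ‖B x y‖ₑ ∂μ ≤ R
  right : ∀ y, ∫⁻ x, ‖B x y‖ₑ ∂μ ≤ R

namespace SchurBound

lemma continuous_left {X : Type*} [TopologicalSpace X] {B : X → X → ℂ} (h : Continuous (Function.uncurry B)) (x : X) :
    Continuous fun y => B x y := h.comp (Continuous.prodMk_right x)

lemma continuous_right {X : Type*} [TopologicalSpace X] {B : X → X → ℂ} (h : Continuous (Function.uncurry B)) (y : X) :
    Continuous fun x => B x y := h.comp (Continuous.prodMk_left y)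

variable {X : Type*} [TopologicalSpace X] [MeasurableSpace X] {μ : Measure X}

lemma mono {B : X → X → ℂ} {R S : ℝ≥0∞} (h : SchurBound μ B R) (hRS : R ≤ S) : SchurBound μ B S :=
  ⟨h.cont, fun x => (h.left x).trans hRS, fun y => (h.right y).trans hRS⟩

lemma congr {B B' : X → X → ℂ} {R : ℝ≥0∞} (h : SchurBound μ B R) (e : ∀ x y, B' x y = B x y) :
    SchurBound μ B' R := by
  have : B' = B := by ext x y; exact e x y
  rwa [this]

lemma neg {B : X → X → ℂ} {S : ℝ≥0∞} (hB : SchurBound μ B S) :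
    SchurBound μ (fun x y => -B x y) S :=
  ⟨hB.cont.neg, fun x => by simpa using hB.left x, fun y => by simpa using hB.right y⟩

variable [OpensMeasurableSpace X]

lemma add {A B : X → X → ℂ} {R S : ℝ≥0∞} (hA : SchurBound μ A R) (hB : SchurBound μ B S) :
    SchurBound μ (fun x y => A x y + B x y) (R + S) := by
  refine ⟨hA.cont.add hB.cont, fun x => ?_, fun y => ?_⟩
  · calc _ ≤ ∫⁻ y, (‖A x y‖ₑ + ‖B x y‖ₑ) ∂μ := lintegral_mono fun y => enorm_add_le _ _
      _ = _ := lintegral_add_left (continuous_left hA.cont x).enorm.measurable _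
      _ ≤ _ := add_le_add (hA.left x) (hB.left x)
  · calc _ ≤ ∫⁻ x, (‖A x y‖ₑ + ‖B x y‖ₑ) ∂μ := lintegral_mono fun y => enorm_add_le _ _
      _ = _ := lintegral_add_left (continuous_right hA.cont y).enorm.measurable _
      _ ≤ _ := add_le_add (hA.right y) (hB.right y)

lemma sub {A B : X → X → ℂ} {R S : ℝ≥0∞} (hA : SchurBound μ A R) (hB : SchurBound μ B S) :
    SchurBound μ (fun x y => A x y - B x y) (R + S) :=
  (hA.add hB.neg).congr fun _ _ => sub_eq_add_neg _ _

lemma sum {ι : Type*} {B : ι → X → X → ℂ} {R : ι → ℝ≥0∞} (s : Finset ι)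
    (h : ∀ i ∈ s, SchurBound μ (B i) (R i)) :
    SchurBound μ (fun x y => ∑ i ∈ s, B i x y) (∑ i ∈ s, R i) := by
  classical
  induction s using Finset.induction_on with
  | empty => exact ⟨by simpa [Function.uncurry_def] using continuous_const, by simp, by simp⟩
  | insert i s hi ih =>
    rw [Finset.sum_insert hi]
    refine ((h i (Finset.mem_insert_self i s)).add
      (ih fun j hj => h j (Finset.mem_insert_of_mem hj))).congr fun x y => ?_
    rw [Finset.sum_insert hi]

end SchurBound

lemma lintegral_enorm_le_of_norm_le {u : Circ → ℂ} {b : Circ → ℝ} (hb : Continuous b)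
    (h : ∀ x, ‖u x‖ ≤ b x) {R : ℝ} (hR : ∫ x, b x ∂circMeasure ≤ R) :
    ∫⁻ x, ‖u x‖ₑ ∂circMeasure ≤ ENNReal.ofReal R := by
  calc _ ≤ ∫⁻ x, ENNReal.ofReal (b x) ∂circMeasure := lintegral_mono fun x => by
        rw [← ofReal_norm]; exact ENNReal.ofReal_le_ofReal (h x)
    _ = ENNReal.ofReal (∫ x, b x ∂circMeasure) :=
        (ofReal_integral_eq_lintegral_ofReal (integrable_of_continuous hb)
          (Filter.Eventually.of_forall fun x => (norm_nonneg _).trans (h x))).symm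
    _ ≤ _ := ENNReal.ofReal_le_ofReal hR

lemma continuous_sampleKer {ϑ lam : ℝ → ℝ} (hϑ : IsCutoff ϑ) {n : ℕ} (hn : 1 ≤ n)
    (hs : Summable fun k : ℤ => |lam k|) : Continuous (Function.uncurry (sampleKer ϑ lam n)) := by
  have h1 := continuous_trig (a := fun k => lam k) hs
  have h2 := continuous_trig (a := fun k => ϑ (k / n)) (by simpa using hϑ.summable hn 1)
  unfold sampleKer Function.uncurry
  fun_prop

lemma schurBound_phi {lam : ℝ → ℝ} (hs : Summable fun k : ℤ => |lam k|) :
    SchurBound circMeasure (fun x y => trig (fun k => lam k) (x - y))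
      (ENNReal.ofReal (∑' k : ℤ, |lam k|)) := by
  have h1 := continuous_trig (a := fun k => lam k) hs
  refine ⟨by unfold Function.uncurry; fun_prop, fun x => ?_, fun y => ?_⟩ <;>
  exact lintegral_enorm_le_of_norm_le continuous_const (fun _ => norm_trig_le hs _) (by simp)

lemma exists_schurBound_phi_sub_sampleKer {r κ : ℝ} (hr : 1 < r) (hκ : 0 ≤ κ) {lam : ℝ → ℝ}
    (h : IsMask r κ lam) {ϑ : ℝ → ℝ} (hϑ : IsCutoff ϑ) :
    ∃ C : ℝ, 0 ≤ C ∧ ∀ n : ℕ, 1 ≤ n → SchurBound circMeasure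
      (fun x y => trig (fun k => lam k) (x - y) - sampleKer ϑ lam n x y)
      (ENNReal.ofReal (C * rate r κ n)) := by
  have hs := h.summable hr hκ hϑ
  obtain ⟨C1, hC1, h1⟩ := exists_highpass_bound hr hκ h hϑ
  obtain ⟨C2, hC2, h2⟩ := exists_highpass_bound hr hκ h hϑ.sq
  obtain ⟨C3, hC3, h3⟩ := exists_lowpass_bound hϑ
  -- The factors 3 and 9 are the integrals of `bump` and `bumpMean`; `C2` belongs to the cut-off
  -- `ϑ²`, which is again admissible.
  refine ⟨3 * C2 + 9 * (C3 * C1), by positivity, fun n hn => ?_⟩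
  have hε := rate_nonneg r κ n
  set ε := rate r κ n
  have hb := continuous_bump n
  set b : Circ → Circ → ℝ := fun x y => C2 * ε * bump n (x - y) + C3 * (C1 * ε) * bumpMean n x y
    with hbdef
  -- Since the majorant is symmetric, the row estimate also serves for the columns.
  have hbcomm : ∀ x y, b x y = b y x := fun x y => by
    simp only [hbdef]; rw [bump_sub_comm, bumpMean_comm]
  have hle : ∀ x y, ‖trig (fun k => lam k) (x - y) - sampleKer ϑ lam n x y‖ ≤ b x y := by
    intro x y
    rw [phi_sub_sampleKer hϑ hn hs]
    refine (norm_sub_le _ _).trans (add_le_add ((h2 n hn).2 _) ?_)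
    rw [norm_mul, norm_inv]
    have e : ‖2 * (n : ℂ) + 1‖ = 2 * n + 1 := by
      rw [show (2 * (n : ℂ) + 1) = ((2 * n + 1 : ℝ) : ℂ) by push_cast; rfl, Complex.norm_real,
        Real.norm_of_nonneg (by positivity)]
    rw [e, bumpMean, mul_left_comm, Finset.mul_sum]
    refine mul_le_mul_of_nonneg_left ((norm_sum_le _ _).trans (Finset.sum_le_sum fun s _ => ?_))
      (by positivity)
    rw [norm_mul, mul_mul_mul_comm]
    exact mul_le_mul (h3 n hn _) ((h1 n hn).2 _) (norm_nonneg _)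
      (mul_nonneg hC3 (bump_nonneg _ _))
  have hbc : ∀ x, Continuous fun y => b x y := fun x => by
    have := continuous_bumpMean n x
    simp only [hbdef]; fun_prop
  have hint : ∀ x, ∫ y, b x y ∂circMeasure ≤ (3 * C2 + 9 * (C3 * C1)) * ε := fun x => by
    have hm := continuous_bumpMean n x
    simp only [hbdef]
    rw [integral_add (integrable_of_continuous (by fun_prop)) (integrable_of_continuous (by fun_prop)),
      integral_const_mul, integral_const_mul, integral_sub_left_eq_self (bump n) circMeasure]
    have a1 := mul_le_mul_of_nonneg_left (integral_bump_le n hn) (mul_nonneg hC2 hε)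
    have a2 := mul_le_mul_of_nonneg_left (integral_bumpMean_le hn x)
      (mul_nonneg hC3 (mul_nonneg hC1 hε))
    linarith
  refine ⟨?_, fun x => ?_, fun y => ?_⟩
  · exact (schurBound_phi hs).cont.sub (continuous_sampleKer hϑ hn hs)
  · exact lintegral_enorm_le_of_norm_le (hbc x) (hle x) (hint x)
  · refine lintegral_enorm_le_of_norm_le (hbc y) (fun x => ?_) (hint y)
    rw [← hbcomm]; exact hle x y

/-! ### Dyadic levels. -/

/-- The rate `2^{-rk} (k+1)^{-κ}` of the `k`-th difference. -/
def dyadicRate (r κ : ℝ) (k : ℕ) : ℝ := (2 : ℝ) ^ (-(r * k)) * ((k : ℝ) + 1) ^ (-κ)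

lemma dyadicRate_nonneg (r κ : ℝ) (k : ℕ) : 0 ≤ dyadicRate r κ k := by
  unfold dyadicRate; positivity

/-- The logarithm at `n = 2^k` grows linearly in `k`: it is at least `1/3` for `k ≤ 1` and at least
`(k-1) log 2` afterwards, in both cases at least `(k+1)/6`. -/
lemma rate_two_pow_le (r : ℝ) {κ : ℝ} (hκ : 0 ≤ κ) (k : ℕ) :
    rate r κ (2 ^ k) ≤ 6 ^ κ * dyadicRate r κ k := by
  have h2 : ((k : ℝ) + 1) / 6 ≤ Real.log ((2 : ℝ) ^ k / 2 + 1) := by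
    rcases le_or_gt k 1 with hk | hk
    · have h1 : (1 : ℝ) ≤ 2 ^ k := one_le_pow₀ (by norm_num)
      have := log_add_one_ge (by linarith : 1 / 2 ≤ (2 : ℝ) ^ k / 2)
      have : (k : ℝ) ≤ 1 := by exact_mod_cast hk
      linarith
    · have hk' : (2 : ℝ) ≤ k := by exact_mod_cast hk
      have h1 : Real.log ((2 : ℝ) ^ k / 2) ≤ Real.log ((2 : ℝ) ^ k / 2 + 1) :=
        Real.log_le_log (by positivity) (by linarith)
      rw [Real.log_div (by positivity) (by norm_num), Real.log_pow] at h1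
      have := Real.log_two_gt_d9
      nlinarith
  have h3 : Real.log ((2 : ℝ) ^ k / 2 + 1) ^ (-κ) ≤ 6 ^ κ * ((k : ℝ) + 1) ^ (-κ) := by
    calc _ ≤ (((k : ℝ) + 1) / 6) ^ (-κ) :=
          Real.rpow_le_rpow_of_nonpos (by positivity) h2 (by linarith)
      _ = _ := by
          rw [Real.div_rpow (by positivity) (by norm_num), Real.rpow_neg (by norm_num : (0:ℝ) ≤ 6),
            div_inv_eq_mul, mul_comm]
  have h4 : (((2 : ℕ) ^ k : ℕ) : ℝ) ^ (-r) = 2 ^ (-(r * k)) := by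
    push_cast
    rw [← Real.rpow_natCast, ← Real.rpow_mul (by norm_num)]
    congr 1; ring
  rw [rate, h4, dyadicRate, mul_left_comm]
  push_cast
  gcongr

lemma dyadicRate_le_succ {r κ : ℝ} (hκ : 0 ≤ κ) (k : ℕ) :
    dyadicRate r κ k ≤ 2 ^ r * 2 ^ κ * dyadicRate r κ (k + 1) := by
  have h1 : (2 : ℝ) ^ (-(r * k)) = 2 ^ r * 2 ^ (-(r * (k + 1 : ℕ))) := by
    rw [← Real.rpow_add (by norm_num)]; congr 1; push_cast; ring
  have h2 : ((k : ℝ) + 1) ^ (-κ) ≤ 2 ^ κ * (((k + 1 : ℕ) : ℝ) + 1) ^ (-κ) := by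
    calc ((k : ℝ) + 1) ^ (-κ) ≤ ((((k + 1 : ℕ) : ℝ) + 1) / 2) ^ (-κ) := by
          refine Real.rpow_le_rpow_of_nonpos (by positivity) ?_ (by linarith)
          push_cast; linarith [(Nat.cast_nonneg k : (0:ℝ) ≤ k)]
      _ = _ := by
          rw [Real.div_rpow (by positivity) (by norm_num), Real.rpow_neg (by norm_num : (0:ℝ) ≤ 2),
            div_inv_eq_mul, mul_comm]
  rw [dyadicRate, dyadicRate, h1]
  calc _ ≤ (2 ^ r * 2 ^ (-(r * (k + 1 : ℕ)))) * (2 ^ κ * (((k + 1 : ℕ) : ℝ) + 1) ^ (-κ)) := by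
        gcongr
    _ = _ := by ring

/-- The kernel of `q_k`. -/
def diffKer (ϑ lam : ℝ → ℝ) : ℕ → Circ → Circ → ℂ
  | 0, x, y => sampleKer ϑ lam 1 x y
  | k + 1, x, y => sampleKer ϑ lam (2 ^ (k + 1)) x y - sampleKer ϑ lam (2 ^ k) x y

lemma sum_diffKer (ϑ lam : ℝ → ℝ) (m : ℕ) (x y : Circ) :
    ∑ k ∈ Finset.range (m + 1), diffKer ϑ lam k x y = sampleKer ϑ lam (2 ^ m) x y := by
  induction m with
  | zero => simp [diffKer]
  | succ m ih => rw [Finset.sum_range_succ, ih, diffKer]; ring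

lemma exists_schurBound_dyadic {r κ : ℝ} (hr : 1 < r) (hκ : 0 ≤ κ) {lam : ℝ → ℝ}
    (h : IsMask r κ lam) {ϑ : ℝ → ℝ} (hϑ : IsCutoff ϑ) :
    ∃ C : ℝ, 0 ≤ C ∧ ∀ k : ℕ,
      SchurBound circMeasure (fun x y => trig (fun k => lam k) (x - y) - sampleKer ϑ lam (2 ^ k) x y)
        (ENNReal.ofReal (C * dyadicRate r κ k)) ∧
      SchurBound circMeasure (diffKer ϑ lam k) (ENNReal.ofReal (C * dyadicRate r κ k)) := by
  obtain ⟨C, hC, hE⟩ := exists_schurBound_phi_sub_sampleKer hr hκ h hϑ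
  have hs := h.summable hr hκ hϑ
  have h6 : (0 : ℝ) ≤ 6 ^ κ := by positivity
  set C1 := C * 6 ^ κ with hC1
  have hC10 : 0 ≤ C1 := by positivity
  have hE' : ∀ k : ℕ, SchurBound circMeasure
      (fun x y => trig (fun k => lam k) (x - y) - sampleKer ϑ lam (2 ^ k) x y)
        (ENNReal.ofReal (C1 * dyadicRate r κ k)) := fun k =>
    (hE (2 ^ k) Nat.one_le_two_pow).mono (ENNReal.ofReal_le_ofReal (by
      rw [hC1, mul_assoc]; exact mul_le_mul_of_nonneg_left (rate_two_pow_le r hκ k) hC))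
  set S := ∑' k : ℤ, |lam k| with hS
  have hS0 : 0 ≤ S := tsum_nonneg fun _ => abs_nonneg _
  -- `q_{k+1}` is a difference of two errors, the coarser costing `2^r 2^κ`. `q_0 = Q_1` is `φ_λ`
  -- minus an error, which adds `S` at level 0, where the rate is 1.
  refine ⟨S + C1 * (2 ^ r * 2 ^ κ) + C1, by positivity, fun k => ⟨?_, ?_⟩⟩
  · refine (hE' k).mono (ENNReal.ofReal_le_ofReal
      (mul_le_mul_of_nonneg_right ?_ (dyadicRate_nonneg _ _ _)))
    have : 0 ≤ C1 * (2 ^ r * 2 ^ κ) := by positivity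
    linarith
  · have hd := dyadicRate_nonneg r κ
    have hpos : 0 ≤ C1 * (2 ^ r * 2 ^ κ) := by positivity
    rcases k with _ | k
    · refine (((schurBound_phi hs).sub (hE' 0)).mono ?_).congr fun x y => ?_
      · rw [← ENNReal.ofReal_add hS0 (mul_nonneg hC10 (hd 0))]
        refine ENNReal.ofReal_le_ofReal ?_
        have : dyadicRate r κ 0 = 1 := by simp [dyadicRate]
        rw [this]; linarith
      · simp [diffKer]
    · refine (((hE' k).sub (hE' (k + 1))).mono ?_).congr fun x y => ?_
      · rw [← ENNReal.ofReal_add (mul_nonneg hC10 (hd _)) (mul_nonneg hC10 (hd _))]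
        refine ENNReal.ofReal_le_ofReal ?_
        have a1 := mul_le_mul_of_nonneg_left (dyadicRate_le_succ (r := r) hκ k) hC10
        have a2 := mul_nonneg hS0 (hd (k + 1))
        linarith
      · simp only [diffKer]; ring

/-! ### Integral operators on the circle and independence of the chosen generator. -/

/-- The integral operator with kernel `K`. -/
def intOp {X : Type*} [MeasurableSpace X] (μ : Measure X) (K : X → X → ℂ) (g : X → ℂ) (x : X) : ℂ :=
  ∫ y, K x y * g y ∂μ

lemma conv_eq_intOp {G : Type*} [AddCommGroup G] [MeasurableSpace G] [MeasurableAdd G]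
    [MeasurableNeg G] (μ : Measure G) [μ.IsAddLeftInvariant] [μ.IsNegInvariant] (φ g : G → ℂ) :
    conv μ φ g = intOp μ (fun x y => φ (x - y)) g := by
  ext x
  rw [conv, convolution_eq_swap]
  rfl

lemma integrable_continuous_mul {X : Type*} [TopologicalSpace X] [CompactSpace X]
    [MeasurableSpace X] [OpensMeasurableSpace X] {μ : Measure X} {u g : X → ℂ}
    (hu : Continuous u) (hg : Integrable g μ) : Integrable (fun y => u y * g y) μ := by
  obtain ⟨C, hC⟩ := isCompact_univ.exists_bound_of_continuousOn hu.continuousOn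
  exact hg.bdd_mul (c := C) hu.aestronglyMeasurable (.of_forall fun x => hC x trivial)

lemma norm_fourierCoeff_le {g : Circ → ℂ} (k : ℤ) :
    ‖fourierCoeff g k‖ ≤ ∫ y, ‖g y‖ ∂circMeasure := by
  refine (norm_integral_le_integral_norm _).trans (le_of_eq ?_)
  simp only [norm_smul, norm_fourier, one_mul]

/-- Absolute summability permits termwise integration at every point. Thus the convolution depends,
everywhere and not just almost everywhere, only on the Fourier coefficients of `g`. -/
lemma hasSum_intOp_trig {a : ℤ → ℝ} (ha : Summable fun k => |a k|) {g : Circ → ℂ}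
    (hg : Integrable g circMeasure) (x : Circ) :
    HasSum (fun k => (a k : ℂ) * fourierCoeff g k * fourier k x)
      (intOp circMeasure (fun x y => trig a (x - y)) g x) := by
  have h := hasSum_integral_of_summable_integral_norm (μ := circMeasure)
    (F := fun k y => (a k : ℂ) * fourier k (x - y) * g y)
    (fun k => integrable_continuous_mul (by fun_prop) hg)
    (by
      simp only [norm_mul _ (g _), norm_coeff_mul_fourier]
      simp_rw [integral_const_mul]
      exact ha.mul_right _)
  have e1 : ∀ k, ∫ y, (a k : ℂ) * fourier k (x - y) * g y ∂circMeasure =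
      (a k : ℂ) * fourierCoeff g k * fourier k x := fun k => by
    rw [fourierCoeff, mul_right_comm, ← integral_const_mul]
    refine integral_congr_ae (.of_forall fun y => ?_)
    simp only [fourier_sub_apply, smul_eq_mul]; ring
  simp_rw [e1] at h
  simpa only [intOp, trig, tsum_mul_right] using h

lemma fourierCoeff_eq_of_hasSum {c : ℤ → ℂ} (hc : Summable fun k => ‖c k‖) {f : Circ → ℂ}
    (hf : ∀ x, HasSum (fun k => c k * fourier k x) (f x)) (j : ℤ) : fourierCoeff f j = c j := by
  have h := hasSum_integral_of_summable_integral_norm (μ := circMeasure)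
    (F := fun k y => fourier (-j) y * (c k * fourier k y))
    (fun k => (show Continuous fun y : Circ => fourier (-j) y * (c k * fourier k y) by
      fun_prop).integrable_of_hasCompactSupport (HasCompactSupport.of_compactSpace _))
    (by simpa only [norm_mul, norm_fourier, one_mul, mul_one, integral_const, probReal_univ,
      one_smul] using hc)
  have e : ∀ k, ∫ y, fourier (-j) y * (c k * fourier k y) ∂circMeasure = if k = j then c j else 0 :=
    fun k => by
      have h1 := congrFun (fourierCoeff_fourier (T := 2 * Real.pi) k) j
      rw [fourierCoeff] at h1
      simp_rw [mul_left_comm _ (c k), integral_const_mul]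
      simp only [smul_eq_mul] at h1
      rw [h1, Pi.single_apply]
      by_cases hk : k = j
      · simp [hk]
      · simp [hk, Ne.symm hk]
  simp_rw [e] at h
  have h2 := h.unique (hasSum_ite_eq j (c j))
  rw [fourierCoeff, ← h2]
  refine integral_congr_ae (.of_forall fun y => ?_)
  simp only [smul_eq_mul]
  rw [tsum_mul_left, (hf y).tsum_eq]

lemma fourierCoeff_intOp_trig {a : ℤ → ℝ} (ha : Summable fun k => |a k|) {g : Circ → ℂ}
    (hg : Integrable g circMeasure) (j : ℤ) :
    fourierCoeff (intOp circMeasure (fun x y => trig a (x - y)) g) j = a j * fourierCoeff g j := by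
  refine fourierCoeff_eq_of_hasSum (c := fun k => (a k : ℂ) * fourierCoeff g k) ?_
    (fun x => hasSum_intOp_trig ha hg x) j
  refine Summable.of_nonneg_of_le (fun _ => norm_nonneg _) (fun k => ?_)
    (ha.mul_right (∫ y, ‖g y‖ ∂circMeasure))
  rw [norm_mul, Complex.norm_real, Real.norm_eq_abs]
  exact mul_le_mul_of_nonneg_left (norm_fourierCoeff_le k) (abs_nonneg _)

lemma fourierCoeff_eq_of_intOp_trig_ae_eq {a : ℤ → ℝ} (ha : Summable fun k => |a k|)
    (ha0 : ∀ k, a k ≠ 0) {g g' : Circ → ℂ} (hg : Integrable g circMeasure)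
    (hg' : Integrable g' circMeasure)
    (h : intOp circMeasure (fun x y => trig a (x - y)) g =ᵐ[circMeasure]
      intOp circMeasure (fun x y => trig a (x - y)) g') (k : ℤ) :
    fourierCoeff g k = fourierCoeff g' k := by
  have h1 := congrFun (fourierCoeff_congr_ae h) k
  rw [fourierCoeff_intOp_trig ha hg, fourierCoeff_intOp_trig ha hg'] at h1
  exact mul_left_cancel₀ (by exact_mod_cast ha0 k) h1

lemma Hker_self {lam : ℝ → ℝ} (h0 : ∀ x, lam x ≠ 0) (ϑ : ℝ → ℝ) (n : ℕ) :
    Hker ϑ lam lam n = trig fun k => ϑ (k / n) := by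
  ext x
  refine tsum_congr fun k => ?_
  rw [div_self (h0 k), mul_one]

/-- The generator selected in `Qop` need only share its Fourier coefficients with `g`, which holds
because `λ` has no zeros; the samples of `H_n * g` are determined by these coefficients. -/
lemma Qop_eq_intOp {lam ϑ : ℝ → ℝ} (h0 : ∀ x, lam x ≠ 0) (hϑ : IsCutoff ϑ)
    (hs : Summable fun k : ℤ => |lam k|) {n : ℕ} (hn : 1 ≤ n) {f g : Circ → ℂ}
    (hg : Integrable g circMeasure)
    (hf : f =ᵐ[circMeasure] intOp circMeasure (fun x y => trig (fun k => lam k) (x - y)) g)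
    (x : Circ) : Qop ϑ lam lam n f x = intOp circMeasure (sampleKer ϑ lam n) g x := by
  have hphi : phi lam = trig fun k => lam k := rfl
  have hϑs : Summable fun k : ℤ => |ϑ (k / n)| := by simpa using hϑ.summable hn 1
  have hex : ∃ g : Circ → ℂ, Integrable g circMeasure ∧
      f =ᵐ[circMeasure] conv circMeasure (phi lam) g := ⟨g, hg, by rwa [conv_eq_intOp]⟩
  rw [Qop, dif_pos hex, Hker_self h0]
  obtain ⟨hg1, hf1⟩ := hex.choose_spec
  generalize hex.choose = G at hg1 hf1 ⊢
  rw [conv_eq_intOp, hphi] at hf1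
  rw [hphi]
  have hc := fourierCoeff_eq_of_intOp_trig_ae_eq (a := fun k => lam k) hs (fun k => h0 k) hg1 hg
    (hf1.symm.trans hf)
  have he : ∀ z, conv circMeasure (trig fun k => ϑ (k / n)) G z =
      ∫ y, trig (fun k => ϑ (k / n)) (z - y) * g y ∂circMeasure := fun z => by
    rw [conv_eq_intOp]
    refine (hasSum_intOp_trig hϑs hg1 z).unique ?_
    simp_rw [hc]
    exact hasSum_intOp_trig hϑs hg z
  have hct := continuous_trig hϑs
  simp_rw [he, intOp, sampleKer, ← integral_mul_const]
  rw [← integral_finsetSum, ← integral_const_mul]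
  · refine integral_congr_ae (.of_forall fun y => ?_)
    simp only [gridPt]
    rw [mul_assoc, Finset.sum_mul]
    congr 1
    exact Finset.sum_congr rfl fun s _ => by ring
  · exact fun s _ => (integrable_continuous_mul (by fun_prop) hg).mul_const _

lemma continuous_diffKer {ϑ lam : ℝ → ℝ} (hϑ : IsCutoff ϑ) (hs : Summable fun k : ℤ => |lam k|)
    (k : ℕ) : Continuous (Function.uncurry (diffKer ϑ lam k)) := by
  rcases k with _ | k
  · exact continuous_sampleKer hϑ le_rfl hs
  · exact (continuous_sampleKer hϑ Nat.one_le_two_pow hs).sub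
      (continuous_sampleKer hϑ Nat.one_le_two_pow hs)

lemma qop_eq_intOp {lam ϑ : ℝ → ℝ} (h0 : ∀ x, lam x ≠ 0) (hϑ : IsCutoff ϑ)
    (hs : Summable fun k : ℤ => |lam k|) (k : ℕ) {f g : Circ → ℂ}
    (hg : Integrable g circMeasure)
    (hf : f =ᵐ[circMeasure] intOp circMeasure (fun x y => trig (fun k => lam k) (x - y)) g)
    (x : Circ) : qop ϑ lam k f x = intOp circMeasure (diffKer ϑ lam k) g x := by
  rcases k with _ | k
  · exact Qop_eq_intOp h0 hϑ hs le_rfl hg hf x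
  · have hi : ∀ m : ℕ, Integrable (fun y => sampleKer ϑ lam (2 ^ m) x y * g y) circMeasure :=
      fun m => integrable_continuous_mul (SchurBound.continuous_left
        (continuous_sampleKer hϑ Nat.one_le_two_pow hs) x) hg
    rw [qop, Pi.sub_apply, Qop_eq_intOp h0 hϑ hs Nat.one_le_two_pow hg hf,
      Qop_eq_intOp h0 hϑ hs Nat.one_le_two_pow hg hf, intOp, intOp, ← integral_sub (hi _) (hi _)]
    simp only [intOp, diffKer, sub_mul]

/-! ### Univariate operators acting in one variable of the torus. -/

instance (d : ℕ) : (torusMeasure d).IsNegInvariant :=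
  Measure.pi.isNegInvariant (μ := fun _ : Fin d => circMeasure)

/-- The overwritten coordinate is integrated out with mass 1. This gives Fubini in the variable
`x_j` without splitting `Fin d`. -/
lemma measurePreserving_update {d : ℕ} (j : Fin d) :
    MeasurePreserving (fun p : Torus d × Circ => Function.update p.1 j p.2)
      ((torusMeasure d).prod circMeasure) (torusMeasure d) := by
  have hm : Measurable fun p : Torus d × Circ => Function.update p.1 j p.2 :=
    (show Continuous fun p : Torus d × Circ => Function.update p.1 j p.2 from
      continuous_fst.update j continuous_snd).measurable
  refine ⟨hm, (Measure.pi_eq fun s hs => ?_).symm⟩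
  rw [Measure.map_apply hm (MeasurableSet.univ_pi hs)]
  have e : (fun p : Torus d × Circ => Function.update p.1 j p.2) ⁻¹' Set.univ.pi s =
      (Set.univ.pi (Function.update s j Set.univ)) ×ˢ s j := by
    ext ⟨y, t⟩
    simp only [Set.mem_preimage, Set.mem_pi, Set.mem_univ, true_implies, Set.mem_prod]
    constructor
    · refine fun h => ⟨fun i => ?_, by simpa using h j⟩
      by_cases hi : i = j
      · subst hi; simp
      · simpa [hi] using h i
    · rintro ⟨h1, h2⟩ i
      by_cases hi : i = j
      · subst hi; simpa using h2
      · simpa [hi] using h1 i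
  rw [e, Measure.prod_prod, Measure.pi_pi, ← Finset.mul_prod_erase _ _ (Finset.mem_univ j),
    ← Finset.mul_prod_erase (a := j) _ (fun i => circMeasure (s i)) (Finset.mem_univ j)]
  simp only [Function.update_self, measure_univ, one_mul]
  rw [mul_comm]
  congr 1
  refine Finset.prod_congr rfl fun i hi => ?_
  rw [Function.update_of_ne (Finset.ne_of_mem_erase hi)]

/-- The tensor product of univariate kernels. -/
def tensorKer {d : ℕ} (B : Fin d → Circ → Circ → ℂ) (x y : Torus d) : ℂ := ∏ l, B l (x l) (y l)

lemma continuous_tensorKer {d : ℕ} {B : Fin d → Circ → Circ → ℂ}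
    (hB : ∀ l, Continuous (Function.uncurry (B l))) : Continuous (Function.uncurry (tensorKer B)) := by
  change Continuous fun p : Torus d × Torus d => ∏ l, B l (p.1 l) (p.2 l)
  exact continuous_finsetProd _ fun l _ => (hB l).comp
    (f := fun p : Torus d × Torus d => (p.1 l, p.2 l)) (by fun_prop)

/-- The part of a function on the torus that remains in the variable `x_j` after the kernels in the
other variables have been applied. -/
def partialOp {d : ℕ} (j : Fin d) (B : Fin d → Circ → Circ → ℂ) (g : Torus d → ℂ) (x : Torus d)
    (s : Circ) : ℂ :=
  ∫ y, (∏ l ∈ Finset.univ.erase j, B l (x l) (y l)) * g (Function.update y j s) ∂torusMeasure d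

lemma partialOp_congr {d : ℕ} (j : Fin d) {B B' : Fin d → Circ → Circ → ℂ}
    (h : ∀ l, l ≠ j → B l = B' l) (g : Torus d → ℂ) (x : Torus d) :
    partialOp j B g x = partialOp j B' g x := by
  ext s
  unfold partialOp
  congr 1; ext y; congr 1
  exact Finset.prod_congr rfl fun l hl => by rw [h l (Finset.ne_of_mem_erase hl)]

lemma prod_erase_update {d : ℕ} (j : Fin d) (B : Fin d → Circ → Circ → ℂ) (x y : Torus d)
    (t s : Circ) :
    ∏ l ∈ Finset.univ.erase j, B l (Function.update x j t l) (Function.update y j s l) =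
      ∏ l ∈ Finset.univ.erase j, B l (x l) (y l) := by
  refine Finset.prod_congr rfl fun l hl => ?_
  rw [Function.update_of_ne (Finset.ne_of_mem_erase hl),
    Function.update_of_ne (Finset.ne_of_mem_erase hl)]

lemma integrable_partialOp {d : ℕ} (j : Fin d) {B : Fin d → Circ → Circ → ℂ}
    (hB : ∀ l, Continuous (Function.uncurry (B l))) {g : Torus d → ℂ}
    (hg : Integrable g (torusMeasure d)) (x : Torus d) :
    Integrable (partialOp j B g x) circMeasure := by
  have hc : Continuous fun y : Torus d => ∏ l ∈ Finset.univ.erase j, B l (x l) (y l) :=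
    continuous_finsetProd _ fun l _ => (SchurBound.continuous_left (hB l) (x l)).comp
      (continuous_apply l)
  have h1 := integrable_continuous_mul hc hg
  have h2 := ((measurePreserving_update j).integrable_comp h1.aestronglyMeasurable).2 h1
  refine h2.integral_prod_right.congr (.of_forall fun s => ?_)
  unfold partialOp
  refine integral_congr_ae (.of_forall fun y => ?_)
  simp only [Function.comp]
  congr 1
  have := prod_erase_update j B x y (x j) s
  rwa [Function.update_eq_self] at this

lemma intOp_tensorKer_update {d : ℕ} (j : Fin d) {B : Fin d → Circ → Circ → ℂ}
    (hB : ∀ l, Continuous (Function.uncurry (B l))) {g : Torus d → ℂ}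
    (hg : Integrable g (torusMeasure d)) (x : Torus d) (t : Circ) :
    intOp (torusMeasure d) (tensorKer B) g (Function.update x j t) =
      intOp circMeasure (B j) (partialOp j B g x) t := by
  have h1 := integrable_continuous_mul
    (SchurBound.continuous_left (continuous_tensorKer hB) (Function.update x j t)) hg
  have hMP := measurePreserving_update j
  have h2 := (hMP.integrable_comp h1.aestronglyMeasurable).2 h1
  unfold intOp
  rw [← hMP.map_eq, integral_map hMP.aemeasurable (by rw [hMP.map_eq]; exact h1.aestronglyMeasurable)]
  refine (integral_prod_symm _ h2).trans ?_
  refine integral_congr_ae (.of_forall fun s => ?_)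
  simp only
  rw [partialOp, ← integral_const_mul]
  refine integral_congr_ae (.of_forall fun y => ?_)
  simp only [Function.comp, tensorKer]
  rw [← Finset.mul_prod_erase _ _ (Finset.mem_univ j), prod_erase_update, Function.update_self,
    Function.update_self, mul_assoc]

/-- By Fubini, for almost every `x` the section of `F` in the variable `x_j` is almost everywhere
`φ_λ` convolved with `partialOp j B g x`. The univariate formula with this generator exchanges the
factor `j` of the tensor kernel. -/
lemma coordOp_qop_ae_eq {lam ϑ : ℝ → ℝ} (h0 : ∀ x, lam x ≠ 0) (hϑ : IsCutoff ϑ)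
    (hs : Summable fun k : ℤ => |lam k|) {d : ℕ} (j : Fin d) (k : ℕ)
    {B B' : Fin d → Circ → Circ → ℂ} (hB : ∀ l, Continuous (Function.uncurry (B l)))
    (hBj : B j = fun x y => trig (fun k => lam k) (x - y)) (hB'j : B' j = diffKer ϑ lam k)
    (hBB' : ∀ l, l ≠ j → B l = B' l) {g : Torus d → ℂ}
    (hg : Integrable g (torusMeasure d)) {F : Torus d → ℂ}
    (hF : F =ᵐ[torusMeasure d] intOp (torusMeasure d) (tensorKer B) g) :
    coordOp j (qop ϑ lam k) F =ᵐ[torusMeasure d] intOp (torusMeasure d) (tensorKer B') g := by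
  have hB' : ∀ l, Continuous (Function.uncurry (B' l)) := fun l => by
    by_cases hl : l = j
    · subst hl; rw [hB'j]; exact continuous_diffKer hϑ hs k
    · rw [← hBB' l hl]; exact hB l
  have h1 := Measure.ae_ae_of_ae_prod ((measurePreserving_update j).quasiMeasurePreserving.ae hF)
  filter_upwards [h1] with x hx
  have h2 : (fun t => F (Function.update x j t)) =ᵐ[circMeasure]
      intOp circMeasure (fun x y => trig (fun k => lam k) (x - y)) (partialOp j B g x) := by
    filter_upwards [hx] with t ht
    rw [ht, intOp_tensorKer_update j hB hg, hBj]
  rw [coordOp, qop_eq_intOp h0 hϑ hs k (integrable_partialOp j hB hg x) h2,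
    partialOp_congr j hBB', ← hB'j, ← intOp_tensorKer_update j hB' hg, Function.update_eq_self]

/-- Variables already processed carry `diffKer`, the others still carry `φ_λ`. Absence of
repetitions guarantees that the next operator meets an untouched factor. -/
lemma foldr_coordOp_ae_eq {lam ϑ : ℝ → ℝ} (h0 : ∀ x, lam x ≠ 0) (hϑ : IsCutoff ϑ)
    (hs : Summable fun k : ℤ => |lam k|) {d : ℕ} (k : Fin d → ℕ) {f g : Torus d → ℂ}
    (hg : Integrable g (torusMeasure d))
    (hf : f =ᵐ[torusMeasure d] intOp (torusMeasure d)
      (tensorKer fun _ x y => trig (fun k => lam k) (x - y)) g)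
    (L : List (Fin d)) (hL : L.Nodup) :
    L.foldr (fun j F => coordOp j (qop ϑ lam (k j)) F) f =ᵐ[torusMeasure d]
      intOp (torusMeasure d) (tensorKer fun l => if l ∈ L then diffKer ϑ lam (k l) else
        fun x y => trig (fun k => lam k) (x - y)) g := by
  induction L with
  | nil => simpa using hf
  | cons j L ih =>
    rw [List.nodup_cons] at hL
    refine coordOp_qop_ae_eq h0 hϑ hs j (k j) (fun l => ?_) ?_ ?_ (fun l hl => ?_) hg (ih hL.2)
    · split_ifs
      · exact continuous_diffKer hϑ hs _
      · exact (schurBound_phi hs).cont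
    · rw [if_neg hL.1]
    · simp
    · simp [hl]

lemma qopTorus_ae_eq {lam ϑ : ℝ → ℝ} (h0 : ∀ x, lam x ≠ 0) (hϑ : IsCutoff ϑ)
    (hs : Summable fun k : ℤ => |lam k|) {d : ℕ} (k : Fin d → ℕ) {f g : Torus d → ℂ}
    (hg : Integrable g (torusMeasure d))
    (hf : f =ᵐ[torusMeasure d] intOp (torusMeasure d)
      (tensorKer fun _ x y => trig (fun k => lam k) (x - y)) g) :
    qopTorus ϑ lam k f =ᵐ[torusMeasure d]
      intOp (torusMeasure d) (tensorKer fun l => diffKer ϑ lam (k l)) g := by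
  have := foldr_coordOp_ae_eq h0 hϑ hs k hg hf (List.finRange d) (List.nodup_finRange d)
  simp only [List.mem_finRange, if_true] at this
  exact this

/-! ### The multivariate kernel as a product. -/

lemma summable_and_tsum_mul {ι ι' : Type*} {u : ι → ℂ} {v : ι' → ℂ}
    (hu : Summable fun i => ‖u i‖) (hv : Summable fun i => ‖v i‖) :
    (Summable fun z : ι × ι' => ‖u z.1 * v z.2‖) ∧
      ∑' z : ι × ι', u z.1 * v z.2 = (∑' i, u i) * ∑' i, v i :=
  ⟨hu.mul_norm hv, (tsum_mul_tsum_of_summable_norm hu hv).symm⟩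

lemma tsum_prod_eq_prod_tsum {d : ℕ} (f : Fin d → ℤ → ℂ) (hf : ∀ l, Summable fun k => ‖f l k‖) :
    (Summable fun j : Fin d → ℤ => ‖∏ l, f l (j l)‖) ∧
      ∑' j : Fin d → ℤ, ∏ l, f l (j l) = ∏ l, ∑' k, f l k := by
  induction d with
  | zero => exact ⟨Summable.of_finite, by simp⟩
  | succ d ih =>
    obtain ⟨h1, h2⟩ := ih (fun l => f l.succ) fun l => hf l.succ
    rw [Fin.prod_univ_succ, ← h2]
    have e : ∀ z : ℤ × (Fin d → ℤ), ∏ l, f l (Fin.consEquiv (fun _ => ℤ) z l) =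
        f 0 z.1 * ∏ l, f l.succ (z.2 l) := fun z => by
      simp [Fin.prod_univ_succ]
    have h3 := (Fin.consEquiv fun _ : Fin (d + 1) => ℤ).tsum_eq fun j => ∏ l, f l (j l)
    rw [← h3, ← (Fin.consEquiv fun _ : Fin (d + 1) => ℤ).summable_iff]
    simp only [Function.comp_def, e]
    obtain ⟨h4, h5⟩ := summable_and_tsum_mul (hf 0) h1
    exact ⟨h4, h5⟩

lemma phiTorus_eq_prod {lam : ℝ → ℝ} (hs : Summable fun k : ℤ => |lam k|) {d : ℕ} (x : Torus d) :
    phiTorus lam d x = ∏ l, trig (fun k => lam k) (x l) := by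
  unfold trig
  rw [← (tsum_prod_eq_prod_tsum (fun l k => (lam k : ℂ) * fourier k (x l)) fun l => ?_).2]
  · refine tsum_congr fun j => ?_
    rw [Finset.prod_mul_distrib]
    push_cast; rfl
  · simpa only [norm_coeff_mul_fourier (fun k => lam k)] using hs

lemma conv_phiTorus {lam : ℝ → ℝ} (hs : Summable fun k : ℤ => |lam k|) {d : ℕ} (g : Torus d → ℂ) :
    conv (torusMeasure d) (phiTorus lam d) g =
      intOp (torusMeasure d) (tensorKer fun _ x y => trig (fun k => lam k) (x - y)) g := by
  rw [conv_eq_intOp]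
  congr 1
  ext x y
  rw [phiTorus_eq_prod hs]
  rfl

/-! ### Schur's test. -/

lemma aestronglyMeasurable_intOp {X : Type*} [TopologicalSpace X] [SecondCountableTopology X]
    [MeasurableSpace X] [BorelSpace X] {μ : Measure X} [SFinite μ] {K : X → X → ℂ}
    (hK : Continuous (Function.uncurry K)) {g : X → ℂ} (hg : AEStronglyMeasurable g μ) :
    AEStronglyMeasurable (intOp μ K g) μ := by
  have h : AEStronglyMeasurable (fun z : X × X => Function.uncurry K z * g z.2) (μ.prod μ) :=
    hK.aestronglyMeasurable.mul hg.comp_snd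
  exact h.integral_prod_right'

lemma enorm_intOp_le {X : Type*} [MeasurableSpace X] (μ : Measure X) (K : X → X → ℂ) (g : X → ℂ)
    (x : X) : ‖intOp μ K g x‖ₑ ≤ ∫⁻ y, ‖K x y‖ₑ * ‖g y‖ₑ ∂μ :=
  (enorm_integral_le_lintegral_enorm _).trans_eq (by simp only [enorm_mul])

/-- This is the comparison of `L^1` and `L^q` norms for the finite or infinite measure `w dμ`. -/
lemma lintegral_mul_rpow_le {X : Type*} [MeasurableSpace X] {μ : Measure X} {w u : X → ℝ≥0∞}
    (hw : Measurable w) (hwt : ∀ x, w x < ∞) (hu : AEMeasurable u μ) {q : ℝ} (hq : 1 ≤ q) :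
    (∫⁻ y, w y * u y ∂μ) ^ q ≤ (∫⁻ y, w y ∂μ) ^ (q - 1) * ∫⁻ y, w y * u y ^ q ∂μ := by
  have hq0 : 0 < q := by linarith
  have hac := withDensity_absolutelyContinuous μ w
  have hu' : AEStronglyMeasurable u (μ.withDensity w) := (hu.mono_ac hac).aestronglyMeasurable
  have h := eLpNorm_le_eLpNorm_mul_rpow_measure_univ (μ := μ.withDensity w) (p := 1)
    (q := ENNReal.ofReal q) (by simpa using hq) hu'
  rw [eLpNorm_one_eq_lintegral_enorm, eLpNorm_eq_lintegral_rpow_enorm_toReal (by simpa using hq0)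
    ENNReal.ofReal_ne_top, ENNReal.toReal_ofReal hq0.le, ENNReal.toReal_one,
    withDensity_apply _ MeasurableSet.univ, setLIntegral_univ,
    lintegral_withDensity_eq_lintegral_mul_non_measurable μ hw (.of_forall hwt),
    lintegral_withDensity_eq_lintegral_mul_non_measurable μ hw (.of_forall hwt)] at h
  simp only [enorm_eq_self, Pi.mul_apply] at h
  have h2 := ENNReal.rpow_le_rpow h hq0.le
  rw [ENNReal.mul_rpow_of_nonneg _ _ hq0.le, ← ENNReal.rpow_mul, ← ENNReal.rpow_mul,
    div_mul_cancel₀ _ hq0.ne', ENNReal.rpow_one] at h2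
  refine h2.trans_eq ?_
  rw [mul_comm]
  congr 2
  field_simp

/-- Schur's test. -/
lemma SchurBound.eLpNorm_intOp_le {X : Type*} [TopologicalSpace X] [SecondCountableTopology X]
    [MeasurableSpace X] [BorelSpace X] {μ : Measure X} [SFinite μ] {K : X → X → ℂ} {R : ℝ≥0∞}
    (hK : SchurBound μ K R) {p : ℝ≥0∞} (hp : 1 ≤ p) {g : X → ℂ}
    (hg : AEStronglyMeasurable g μ) : eLpNorm (intOp μ K g) p μ ≤ R * eLpNorm g p μ := by
  rcases eq_or_ne p ∞ with rfl | hpt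
  · rw [eLpNorm_exponent_top, eLpNorm_exponent_top]
    refine eLpNormEssSup_le_of_ae_enorm_bound (.of_forall fun x => ?_)
    calc _ ≤ ∫⁻ y, ‖K x y‖ₑ * ‖g y‖ₑ ∂μ := enorm_intOp_le μ K g x
      _ ≤ ∫⁻ y, ‖K x y‖ₑ * eLpNormEssSup g μ ∂μ := by
          refine lintegral_mono_ae ?_
          filter_upwards [enorm_ae_le_eLpNormEssSup g μ] with y hy
          gcongr
      _ = (∫⁻ y, ‖K x y‖ₑ ∂μ) * eLpNormEssSup g μ :=
          lintegral_mul_const _ (continuous_left hK.cont x).enorm.measurable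
      _ ≤ _ := by gcongr; exact hK.left x
  · have hp0 : p ≠ 0 := (zero_lt_one.trans_le hp).ne'
    set q := p.toReal with hq
    have hq1 : 1 ≤ q := by
      rw [hq, ← ENNReal.toReal_one]; exact ENNReal.toReal_mono hpt hp
    have hq0 : 0 < q := by linarith
    rw [eLpNorm_eq_lintegral_rpow_enorm_toReal hp0 hpt,
      eLpNorm_eq_lintegral_rpow_enorm_toReal hp0 hpt, ← hq]
    have hm : AEMeasurable (fun z : X × X => ‖K z.1 z.2‖ₑ * ‖g z.2‖ₑ ^ q) (μ.prod μ) :=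
      (hK.cont.enorm.measurable.aemeasurable).mul (hg.comp_snd.enorm.pow_const q)
    have h1 : ∫⁻ x, ‖intOp μ K g x‖ₑ ^ q ∂μ ≤ R ^ q * ∫⁻ y, ‖g y‖ₑ ^ q ∂μ := by
      -- The weight `|K(x,·)|` costs `R^{q-1}` through the row bound; after exchanging the integrals
      -- the column bound supplies the last factor `R`.
      calc _ ≤ ∫⁻ x, R ^ (q - 1) * ∫⁻ y, ‖K x y‖ₑ * ‖g y‖ₑ ^ q ∂μ ∂μ := by
            refine lintegral_mono fun x => ?_
            refine (ENNReal.rpow_le_rpow (enorm_intOp_le μ K g x) hq0.le).trans ?_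
            refine (lintegral_mul_rpow_le (continuous_left hK.cont x).enorm.measurable
              (fun y => enorm_lt_top) hg.enorm hq1).trans ?_
            gcongr
            exact hK.left x
        _ = R ^ (q - 1) * ∫⁻ x, ∫⁻ y, ‖K x y‖ₑ * ‖g y‖ₑ ^ q ∂μ ∂μ :=
            lintegral_const_mul'' _ hm.lintegral_prod_right'
        _ = R ^ (q - 1) * ∫⁻ y, ∫⁻ x, ‖K x y‖ₑ * ‖g y‖ₑ ^ q ∂μ ∂μ := by
            rw [lintegral_lintegral_swap hm]
        _ = R ^ (q - 1) * ∫⁻ y, (∫⁻ x, ‖K x y‖ₑ ∂μ) * ‖g y‖ₑ ^ q ∂μ := by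
            congr 1
            refine lintegral_congr fun y => ?_
            rw [lintegral_mul_const _ (continuous_right hK.cont y).enorm.measurable]
        _ ≤ R ^ (q - 1) * ∫⁻ y, R * ‖g y‖ₑ ^ q ∂μ := by
            gcongr with y
            exact hK.right y
        _ = R ^ (q - 1) * (R * ∫⁻ y, ‖g y‖ₑ ^ q ∂μ) := by
            rw [lintegral_const_mul'' _ (hg.enorm.pow_const q)]
        _ = R ^ q * ∫⁻ y, ‖g y‖ₑ ^ q ∂μ := by
            rw [← mul_assoc]
            congr 1
            conv_lhs => rw [← ENNReal.rpow_one R, ← ENNReal.rpow_mul, one_mul]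
            rw [← ENNReal.rpow_add_of_nonneg _ _ (by linarith) zero_le_one, sub_add_cancel]
    calc _ ≤ (R ^ q * ∫⁻ y, ‖g y‖ₑ ^ q ∂μ) ^ (1 / q) := ENNReal.rpow_le_rpow h1 (by positivity)
      _ = _ := by
          rw [ENNReal.mul_rpow_of_nonneg _ _ (by positivity), ← ENNReal.rpow_mul,
            mul_one_div_cancel hq0.ne', ENNReal.rpow_one]

/-! ### Tensor products and the induction on the dimension. -/

lemma lintegral_torus_succ {d : ℕ} {u : Circ → ℝ≥0∞} {v : Torus d → ℝ≥0∞} (hu : Measurable u)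
    (hv : Measurable v) :
    ∫⁻ y, u (y 0) * v (fun l => y l.succ) ∂torusMeasure (d + 1) =
      (∫⁻ s, u s ∂circMeasure) * ∫⁻ z, v z ∂torusMeasure d := by
  have h := (measurePreserving_piFinSuccAbove (fun _ : Fin (d + 1) => circMeasure) 0).lintegral_comp
    (f := fun z : Circ × Torus d => u z.1 * v z.2) (by fun_prop)
  rw [lintegral_prod_mul hu.aemeasurable hv.aemeasurable] at h
  exact h

lemma SchurBound.tensor {d : ℕ} {A : Circ → Circ → ℂ} {B : Torus d → Torus d → ℂ} {R S : ℝ≥0∞}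
    (hA : SchurBound circMeasure A R) (hB : SchurBound (torusMeasure d) B S) :
    SchurBound (torusMeasure (d + 1))
      (fun x y => A (x 0) (y 0) * B (fun l => x l.succ) fun l => y l.succ) (R * S) := by
  refine ⟨?_, fun x => ?_, fun y => ?_⟩
  · have h1 := hA.cont.comp (f := fun p : Torus (d + 1) × Torus (d + 1) => (p.1 0, p.2 0))
      (by fun_prop)
    have h2 := hB.cont.comp (f := fun p : Torus (d + 1) × Torus (d + 1) =>
      ((fun l => p.1 (Fin.succ l) : Torus d), (fun l => p.2 (Fin.succ l) : Torus d)))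
      (by fun_prop)
    exact h1.mul h2
  · simp only [enorm_mul]
    rw [lintegral_torus_succ (continuous_left hA.cont (x 0)).enorm.measurable
      (continuous_left hB.cont fun l => x l.succ).enorm.measurable]
    exact mul_le_mul' (hA.left _) (hB.left _)
  · simp only [enorm_mul]
    rw [lintegral_torus_succ (u := fun s => ‖A s (y 0)‖ₑ)
      (v := fun z => ‖B z fun l => y l.succ‖ₑ)
      (continuous_right hA.cont (y 0)).enorm.measurable
      (continuous_right hB.cont fun l => y l.succ).enorm.measurable]
    exact mul_le_mul' (hA.right _) (hB.right _)

/-- The kernel `φ_{λ,d}(x - y)`. -/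
def fullKer (lam : ℝ → ℝ) (d : ℕ) : Torus d → Torus d → ℂ :=
  tensorKer fun _ x y => trig (fun k => lam k) (x - y)

lemma fullKer_succ (lam : ℝ → ℝ) (d : ℕ) (x y : Torus (d + 1)) :
    fullKer lam (d + 1) x y = trig (fun k => lam k) (x 0 - y 0) *
      fullKer lam d (fun l => x l.succ) fun l => y l.succ :=
  Fin.prod_univ_succ _

lemma schurBound_fullKer {lam : ℝ → ℝ} (hs : Summable fun k : ℤ => |lam k|) (d : ℕ) :
    SchurBound (torusMeasure d) (fullKer lam d) (ENNReal.ofReal (∑' k : ℤ, |lam k|) ^ d) := by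
  induction d with
  | zero =>
    have h : ∀ x y, fullKer lam 0 x y = 1 := fun x y => by simp [fullKer, tensorKer]
    refine ⟨?_, fun x => by simp [h], fun x => by simp [h]⟩
    exact continuous_const.congr fun p => (h p.1 p.2).symm
  | succ d ih =>
    rw [pow_succ']
    exact ((schurBound_phi hs).tensor ih).congr fun x y => fullKer_succ lam d x y

/-- The index set of the sparse grid operator. -/
def sparseIndex (d m : ℕ) : Finset (Fin d → ℕ) :=
  {k ∈ Fintype.piFinset fun _ : Fin d => Finset.range (m + 1) | ∑ j, k j ≤ m}

lemma mem_sparseIndex {d m : ℕ} {k : Fin d → ℕ} : k ∈ sparseIndex d m ↔ ∑ j, k j ≤ m := by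
  simp only [sparseIndex, Finset.mem_filter, Fintype.mem_piFinset, Finset.mem_range,
    and_iff_right_iff_imp]
  intro h j
  have := Finset.single_le_sum (f := k) (fun _ _ => Nat.zero_le _) (Finset.mem_univ j)
  omega

/-- The kernel of the sparse grid operator. -/
def sparseKer (ϑ lam : ℝ → ℝ) (d m : ℕ) (x y : Torus d) : ℂ :=
  ∑ k ∈ sparseIndex d m, tensorKer (fun l => diffKer ϑ lam (k l)) x y

/-- Fixing the first level `k` leaves the budget `m - k` for the other variables. -/
lemma sparseKer_succ (ϑ lam : ℝ → ℝ) (d m : ℕ) (x y : Torus (d + 1)) :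
    sparseKer ϑ lam (d + 1) m x y = ∑ k ∈ Finset.range (m + 1), diffKer ϑ lam k (x 0) (y 0) *
      sparseKer ϑ lam d (m - k) (fun l => x l.succ) fun l => y l.succ := by
  simp_rw [sparseKer, Finset.mul_sum]
  rw [Finset.sum_sigma']
  refine Finset.sum_bij' (fun k _ => ⟨k 0, fun l => k l.succ⟩) (fun z _ => Fin.cons z.1 z.2)
    (fun k hk => ?_) (fun z hz => ?_) (fun k _ => ?_) (fun z _ => ?_) (fun k _ => ?_)
  · rw [mem_sparseIndex, Fin.sum_univ_succ] at hk
    rw [Finset.mem_sigma, Finset.mem_range, mem_sparseIndex]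
    dsimp only
    omega
  · rw [Finset.mem_sigma, Finset.mem_range, mem_sparseIndex] at hz
    rw [mem_sparseIndex, Fin.sum_univ_succ]
    simp only [Fin.cons_zero, Fin.cons_succ]
    omega
  · exact Fin.cons_self_tail k
  · simp
  · exact Fin.prod_univ_succ _

lemma sparseKer_zero (ϑ lam : ℝ → ℝ) (m : ℕ) (x y : Torus 0) : sparseKer ϑ lam 0 m x y = 1 := by
  have h : ∀ k, k ∈ sparseIndex 0 m := fun k => by simp [mem_sparseIndex]
  rw [sparseKer, Finset.sum_eq_card_nsmul (b := 1) fun k _ => by simp [tensorKer],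
    Finset.card_eq_of_equiv_fin (n := 1)]
  · simp
  · exact (Equiv.subtypeUnivEquiv h).trans (Equiv.ofUnique _ _)

/-- Adding and subtracting `Q_{2^m} ⊗ Φ_d = ∑_{k ≤ m} q_k ⊗ Φ_d` splits the error into a univariate
error at level `m` and errors in `d` variables at the levels `m - k`. -/
lemma schurBound_fullKer_sub_sparseKer_succ {lam ϑ : ℝ → ℝ} {d m : ℕ} {Φ : ℝ≥0∞}
    {D E R : ℕ → ℝ≥0∞} (hΦ : SchurBound (torusMeasure d) (fullKer lam d) Φ)
    (hE : ∀ k, SchurBound circMeasure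
      (fun x y => trig (fun k => lam k) (x - y) - sampleKer ϑ lam (2 ^ k) x y) (E k))
    (hD : ∀ k, SchurBound circMeasure (diffKer ϑ lam k) (D k))
    (hR : ∀ j, SchurBound (torusMeasure d)
      (fun x y => fullKer lam d x y - sparseKer ϑ lam d j x y) (R j)) :
    SchurBound (torusMeasure (d + 1))
      (fun x y => fullKer lam (d + 1) x y - sparseKer ϑ lam (d + 1) m x y)
      (E m * Φ + ∑ k ∈ Finset.range (m + 1), D k * R (m - k)) := by
  refine (((hE m).tensor hΦ).add (SchurBound.sum (Finset.range (m + 1)) fun k _ =>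
    (hD k).tensor (hR (m - k)))).congr fun x y => ?_
  simp only [mul_sub, Finset.sum_sub_distrib]
  rw [fullKer_succ, sparseKer_succ, ← Finset.sum_mul, sum_diffKer]
  ring

lemma dyadicRate_mul_le {r κ : ℝ} (hκ : 0 ≤ κ) {k m : ℕ} (hk : k ≤ m) :
    dyadicRate r κ k * dyadicRate r κ (m - k) ≤ dyadicRate r κ m := by
  obtain ⟨j, rfl⟩ := Nat.exists_eq_add_of_le hk
  rw [Nat.add_sub_cancel_left]
  have h1 : (2 : ℝ) ^ (-(r * k)) * 2 ^ (-(r * j)) = 2 ^ (-(r * (k + j : ℕ))) := by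
    rw [← Real.rpow_add (by norm_num)]; congr 1; push_cast; ring
  have h2 : ((k : ℝ) + 1) ^ (-κ) * ((j : ℝ) + 1) ^ (-κ) ≤ (((k + j : ℕ) : ℝ) + 1) ^ (-κ) := by
    rw [← Real.mul_rpow (by positivity) (by positivity)]
    refine Real.rpow_le_rpow_of_nonpos (by positivity) ?_ (by linarith)
    push_cast
    nlinarith [mul_nonneg (Nat.cast_nonneg k : (0:ℝ) ≤ k) (Nat.cast_nonneg j : (0:ℝ) ≤ j)]
  unfold dyadicRate
  rw [← h1]
  calc _ = ((2 : ℝ) ^ (-(r * k)) * 2 ^ (-(r * j))) *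
        (((k : ℝ) + 1) ^ (-κ) * ((j : ℝ) + 1) ^ (-κ)) := by ring
    _ ≤ _ := by gcongr

/-- By `dyadicRate_mul_le` each of the `m+1` terms of the recursion is at most a constant times
`dyadicRate r κ m * (m+1)^d`, so a new variable raises the power by one. -/
lemma exists_schurBound_fullKer_sub_sparseKer {r κ : ℝ} (hr : 1 < r) (hκ : 0 ≤ κ) {lam : ℝ → ℝ}
    (h : IsMask r κ lam) {ϑ : ℝ → ℝ} (hϑ : IsCutoff ϑ) (d : ℕ) :
    ∃ C : ℝ, 0 ≤ C ∧ ∀ m : ℕ, SchurBound (torusMeasure (d + 1))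
      (fun x y => fullKer lam (d + 1) x y - sparseKer ϑ lam (d + 1) m x y)
      (ENNReal.ofReal (C * (dyadicRate r κ m * ((m : ℝ) + 1) ^ d))) := by
  obtain ⟨C1, hC1, hb⟩ := exists_schurBound_dyadic hr hκ h hϑ
  have hs := h.summable hr hκ hϑ
  have hd := dyadicRate_nonneg r κ
  set S := ∑' k : ℤ, |lam k|
  have hS : 0 ≤ S := tsum_nonneg fun _ => abs_nonneg _
  induction d with
  | zero =>
    refine ⟨C1, hC1, fun m => ?_⟩
    -- On the zero-dimensional torus both kernels are 1. The sum in the recursion therefore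
    -- vanishes, and the first variable costs no power of `m+1`.
    have h0 : ∀ j, SchurBound (torusMeasure 0)
        (fun x y => fullKer lam 0 x y - sparseKer ϑ lam 0 j x y) 0 := fun j => by
      have e : ∀ x y, fullKer lam 0 x y - sparseKer ϑ lam 0 j x y = 0 := fun x y => by
        rw [sparseKer_zero]; simp [fullKer, tensorKer]
      exact ⟨continuous_const.congr fun p => (e p.1 p.2).symm, fun x => by simp [e],
        fun y => by simp [e]⟩
    refine (schurBound_fullKer_sub_sparseKer_succ (m := m) (schurBound_fullKer hs 0)
      (fun k => (hb k).1) (fun k => (hb k).2) h0).mono (le_of_eq ?_)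
    simp
  | succ d ih =>
    obtain ⟨C, hC, hR⟩ := ih
    refine ⟨C1 * S ^ (d + 1) + C1 * C, by positivity, fun m => ?_⟩
    refine (schurBound_fullKer_sub_sparseKer_succ (m := m) (schurBound_fullKer hs (d + 1))
      (fun k => (hb k).1) (fun k => (hb k).2) hR).mono ?_
    have hdm := hd m
    have e1 : ENNReal.ofReal (C1 * dyadicRate r κ m) * ENNReal.ofReal S ^ (d + 1) ≤
        ENNReal.ofReal (C1 * S ^ (d + 1) * (dyadicRate r κ m * ((m : ℝ) + 1) ^ (d + 1))) := by
      rw [← ENNReal.ofReal_pow hS, ← ENNReal.ofReal_mul (by positivity)]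
      refine ENNReal.ofReal_le_ofReal ?_
      have : (1 : ℝ) ≤ ((m : ℝ) + 1) ^ (d + 1) :=
        one_le_pow₀ (by linarith [(Nat.cast_nonneg m : (0:ℝ) ≤ m)])
      calc C1 * dyadicRate r κ m * S ^ (d + 1) = C1 * S ^ (d + 1) * (dyadicRate r κ m * 1) := by
            ring
        _ ≤ _ := by gcongr
    have e2 : ∑ k ∈ Finset.range (m + 1), ENNReal.ofReal (C1 * dyadicRate r κ k) *
          ENNReal.ofReal (C * (dyadicRate r κ (m - k) * (((m - k : ℕ) : ℝ) + 1) ^ d)) ≤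
        ENNReal.ofReal (C1 * C * (dyadicRate r κ m * ((m : ℝ) + 1) ^ (d + 1))) := by
      calc _ ≤ ∑ k ∈ Finset.range (m + 1),
            ENNReal.ofReal (C1 * C * (dyadicRate r κ m * ((m : ℝ) + 1) ^ d)) := by
            refine Finset.sum_le_sum fun k hk => ?_
            have hkm : k ≤ m := by rw [Finset.mem_range] at hk; omega
            rw [← ENNReal.ofReal_mul (mul_nonneg hC1 (hd k))]
            refine ENNReal.ofReal_le_ofReal ?_
            have hle : ((m - k : ℕ) : ℝ) + 1 ≤ m + 1 := by
              have : ((m - k : ℕ) : ℝ) ≤ m := by exact_mod_cast Nat.sub_le m k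
              linarith
            calc _ = C1 * C * ((dyadicRate r κ k * dyadicRate r κ (m - k)) *
                  (((m - k : ℕ) : ℝ) + 1) ^ d) := by ring
              _ ≤ _ := by
                  gcongr
                  exact dyadicRate_mul_le hκ hkm
        _ = _ := by
            rw [Finset.sum_const, Finset.card_range, nsmul_eq_mul, ← ENNReal.ofReal_natCast,
              ← ENNReal.ofReal_mul (by positivity)]
            congr 1
            push_cast; ring
    refine (add_le_add e1 e2).trans_eq ?_
    rw [← ENNReal.ofReal_add (by positivity) (by positivity), ← add_mul]

/-! ### The operator `P_m` and the final estimate. -/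

lemma Pop_ae_eq {lam ϑ : ℝ → ℝ} (h0 : ∀ x, lam x ≠ 0) (hϑ : IsCutoff ϑ)
    (hs : Summable fun k : ℤ => |lam k|) {d : ℕ} (m : ℕ) {f g : Torus d → ℂ}
    (hg : Integrable g (torusMeasure d))
    (hf : f =ᵐ[torusMeasure d] intOp (torusMeasure d) (fullKer lam d) g) :
    Pop ϑ lam m f =ᵐ[torusMeasure d] intOp (torusMeasure d) (sparseKer ϑ lam d m) g := by
  have h1 : ∀ᵐ x ∂torusMeasure d, ∀ k ∈ sparseIndex d m, qopTorus ϑ lam k f x =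
      intOp (torusMeasure d) (tensorKer fun l => diffKer ϑ lam (k l)) g x :=
    (Finset.eventually_all _).2 fun k _ => qopTorus_ae_eq h0 hϑ hs k hg hf
  filter_upwards [h1] with x hx
  have e : Pop ϑ lam m f x = ∑ k ∈ sparseIndex d m, qopTorus ϑ lam k f x :=
    Finset.sum_apply _ _ _
  rw [e, Finset.sum_congr rfl hx]
  simp only [intOp, sparseKer, Finset.sum_mul]
  exact (integral_finsetSum _ fun k _ => integrable_continuous_mul (SchurBound.continuous_left
    (continuous_tensorKer fun l => continuous_diffKer hϑ hs _) x) hg).symm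

lemma dyadicRate_mul_pow_le {r κ : ℝ} (hκ : 0 ≤ κ) (d : ℕ) {m : ℕ} (hm : 1 ≤ m) :
    dyadicRate r κ m * ((m : ℝ) + 1) ^ d ≤
      2 ^ d * ((2 : ℝ) ^ (-(r * m)) * (m : ℝ) ^ (((d + 1 : ℕ) : ℝ) - 1 - κ)) := by
  have hm1 : (1 : ℝ) ≤ m := by exact_mod_cast hm
  have h1 : ((m : ℝ) + 1) ^ (-κ) ≤ (m : ℝ) ^ (-κ) :=
    Real.rpow_le_rpow_of_nonpos (by positivity) (by linarith) (by linarith)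
  have h2 : ((m : ℝ) + 1) ^ d ≤ (2 * m) ^ d := by gcongr; linarith
  have h3 : (m : ℝ) ^ (((d + 1 : ℕ) : ℝ) - 1 - κ) = (m : ℝ) ^ d * (m : ℝ) ^ (-κ) := by
    rw [← Real.rpow_natCast, ← Real.rpow_add (by positivity)]
    congr 1; push_cast; ring
  rw [h3, dyadicRate]
  calc _ ≤ (2 : ℝ) ^ (-(r * m)) * (m : ℝ) ^ (-κ) * (2 * m) ^ d := by gcongr
    _ = _ := by rw [mul_pow]; ring

end

end SparseGrid

open SparseGrid in
theorem mainTheorem5 (d : ℕ) (hd : 1 ≤ d) (p : ℝ≥0∞) (hp : 1 ≤ p) (r κ : ℝ) (hr : 1 < r)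
    (hκ : 0 ≤ κ) (ϑ : ℝ → ℝ) (hϑ : SparseGrid.IsCutoff ϑ) (lam : ℝ → ℝ)
    (hlam_ne : ∀ x, lam x ≠ 0) (hlam : SparseGrid.IsMask r κ lam) :
    ∃ C : ℝ, 0 < C ∧ ∀ m : ℕ, 1 ≤ m → ∀ f ∈ SparseGrid.hSpace lam p d,
      MemLp (SparseGrid.Pop ϑ lam m f) p (SparseGrid.torusMeasure d) ∧
      eLpNorm (f - SparseGrid.Pop ϑ lam m f) p (SparseGrid.torusMeasure d) ≤
        ENNReal.ofReal (C * (2 : ℝ) ^ (-(r * m)) * (m : ℝ) ^ ((d : ℝ) - 1 - κ)) *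
          SparseGrid.hNorm lam p f := by
  obtain ⟨d, rfl⟩ := Nat.exists_eq_add_of_le' hd
  have hs := hlam.summable hr hκ hϑ
  obtain ⟨C, hC, hS⟩ := exists_schurBound_fullKer_sub_sparseKer hr hκ hlam hϑ d
  have hF := schurBound_fullKer hs (d + 1)
  -- `2^d` comes from `m + 1 ≤ 2m`. The added 1 makes the constant positive even if `C = 0`, which
  -- is also needed to move it inside the infimum defining `hNorm`.
  refine ⟨C * 2 ^ d + 1, by positivity, fun m hm f hf => ?_⟩
  have hm0 : (0 : ℝ) < m := by exact_mod_cast hm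
  have hgen : ∀ g, IsGenerator lam p f g → Integrable g (torusMeasure (d + 1)) ∧
      f =ᵐ[torusMeasure (d + 1)] intOp (torusMeasure (d + 1)) (fullKer lam (d + 1)) g := by
    intro g hg
    exact ⟨hg.1.integrable hp, by have h := hg.2; rw [conv_phiTorus hs] at h; exact h⟩
  constructor
  · obtain ⟨g, hg⟩ := hf
    obtain ⟨hgi, hfg⟩ := hgen g hg
    -- The sparse kernel is the full kernel minus the error kernel, so its boundedness needs no
    -- separate estimate.
    have hK : SchurBound (torusMeasure (d + 1)) (sparseKer ϑ lam (d + 1) m) _ :=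
      (hF.sub (hS m)).congr fun x y => (sub_sub_cancel _ _).symm
    refine (memLp_congr_ae (Pop_ae_eq hlam_ne hϑ hs m hgi hfg)).2
      ⟨aestronglyMeasurable_intOp hK.cont hg.1.1, (hK.eLpNorm_intOp_le hp hg.1.1).trans_lt ?_⟩
    exact ENNReal.mul_lt_top (ENNReal.add_lt_top.2 ⟨ENNReal.pow_lt_top ENNReal.ofReal_lt_top,
      ENNReal.ofReal_lt_top⟩) hg.1.2
  · have hc : ENNReal.ofReal ((C * 2 ^ d + 1) * (2 : ℝ) ^ (-(r * m)) *
        (m : ℝ) ^ (((d + 1 : ℕ) : ℝ) - 1 - κ)) ≠ 0 := by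
      rw [Ne, ENNReal.ofReal_eq_zero, not_le]; positivity
    rw [hNorm, ENNReal.mul_iInf_of_ne hc ENNReal.ofReal_ne_top]
    refine le_iInf fun g => ?_
    rw [ENNReal.mul_iInf_of_ne hc ENNReal.ofReal_ne_top]
    refine le_iInf fun hg => ?_
    obtain ⟨hgi, hfg⟩ := hgen g hg
    have hK : SchurBound (torusMeasure (d + 1)) (sparseKer ϑ lam (d + 1) m) _ :=
      (hF.sub (hS m)).congr fun x y => (sub_sub_cancel _ _).symm
    have he : f - Pop ϑ lam m f =ᵐ[torusMeasure (d + 1)] intOp (torusMeasure (d + 1))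
        (fun x y => fullKer lam (d + 1) x y - sparseKer ϑ lam (d + 1) m x y) g := by
      filter_upwards [hfg, Pop_ae_eq hlam_ne hϑ hs m hgi hfg] with x h1 h2
      rw [Pi.sub_apply, h1, h2]
      simp only [intOp, sub_mul]
      exact (integral_sub (integrable_continuous_mul (SchurBound.continuous_left hF.cont x) hgi)
        (integrable_continuous_mul (SchurBound.continuous_left hK.cont x) hgi)).symm
    rw [eLpNorm_congr_ae he]
    refine ((hS m).eLpNorm_intOp_le hp hg.1.1).trans (mul_le_mul' (ENNReal.ofReal_le_ofReal ?_) le_rfl)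
    have h1 := mul_le_mul_of_nonneg_left (dyadicRate_mul_pow_le (r := r) hκ d hm) hC
    have h2 : 0 ≤ (2 : ℝ) ^ (-(r * m)) * (m : ℝ) ^ (((d + 1 : ℕ) : ℝ) - 1 - κ) := by positivity
    calc _ ≤ _ := h1
      _ ≤ C * (2 ^ d * ((2 : ℝ) ^ (-(r * m)) * (m : ℝ) ^ (((d + 1 : ℕ) : ℝ) - 1 - κ))) +
          (2 : ℝ) ^ (-(r * m)) * (m : ℝ) ^ (((d + 1 : ℕ) : ℝ) - 1 - κ) := le_add_of_nonneg_right h2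
      _ = _ := by ring
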